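/- Let $G$ be a finite undirected multigraph with $n\ge 2$ vertices and minimum cut value $\lambda$, let $p\in(0,1)$, and assume $p^{\lambda}<n^{-1000}$ (so $G$ is connected). A cut $C$ is the set of edges crossing a bipartition of the vertices into two nonempty sides, and $z'_G(p)=\sum_{C:\,|C|<1.1\lambda}p^{|C|}$. \textbf{Levels.} Take any Gomory--Hu tree of $G$, i.e. a weighted tree on $V(G)$ such that for all $u\neq v$ some minimum $(u,v)$-cut of the tree has the same bipartition and the same value as a minimum $(u,v)$-cut of $G$. Let $c_1\le\dots\le c_{n-1}$ be the values of its $n-1$ tree-edge cuts and $c_n=\max\{c_{n-1},1.1\lambda\}$. Let $\Lambda=\lfloor\log_2\log_2 n\rfloor$, $k_i=\lfloor n^{1-2^{-i}}\rfloor$ for $1\le i\le\Lambda$, and $k_{\Lambda+1}=n$. For $1\le i\le \Lambda+1$, let $G_i$ be obtained from $G$ by contracting every $c_{k_i}$-connected component (class of vertices pairwise not separated by any cut with fewer than $c_{k_i}$ edges) and deleting loops. \textbf{Packings.} A greedy tree packing of $N$ trees on a graph is a sequence $T_1,\dots,T_N$ of spanning trees in which each $T_j$ is a minimum spanning tree for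 the edge weights $e\mapsto|\{j'<j: e\in T_{j'}\}|/(j-1)$ (zero if $j=1$), ties being broken arbitrarily. Let $0<\varepsilon\le 0.01$, and let $\mathcal T_i$ be a greedy tree packing of $N_i\ge1$ trees on $G_i$, where $N_i\ge 6\lambda\ln|E(G_i)|/\varepsilon^2$ (with $\ln 0=0$). Form $\widetilde{\mathcal T}_i$ by drawing $r_i$ trees from $\mathcal T_i$ independently and uniformly with replacement, independently for all $i$. \textbf{Sampler.} Given the $\widetilde{\mathcal T}_i$, pick $i\in\{1,\dots,\Lambda+1\}$ uniformly, then $T\in\widetilde{\mathcal T}_i$ uniformly (with multiplicity), then two edges $e,f$ of $T$ independently and uniformly (with replacement), and return the cut $C$ of $G_i$ (which is also a cut of $G$) with $C\cap T=\{e,f\}$; no cut is returned if $G_i$ has a single vertex. Let $q(C)$ be the probability, given the $\widetilde{\mathcal T}_i$, that $C$ is returned, and let $\rho(C)=\dfrac{p^{|C|}}{q(C)\,z'_G(p)}$ be its likelihood ratio. \textbf{Lemma.} For every $d\in\mathbb N$ there is a constant $A>0$ such that for all constants $B\in\mathbb R$, $b\in\mathbb N$ there are constants $K\in\mathbb R$,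 $k\in\mathbb N$ with the following property. In every situation as above with $A\ln n\le r_i\le B(\ln n)^b$ for all $i$, with probability at least $1-n^{-d}$ over the choice of the $\widetilde{\mathcal T}_i$, every cut $C$ of $G$ with $|C|<1.1\lambda$ satisfies $$q(C)>0\qquad\text{and}\qquad \rho(C)\le K\,n\,(\ln n)^{k}.$$ That is, with high probability all these likelihood ratios are $\tilde O(n)$. -/

import Mathlib

universe u v

open scoped Classical

noncomputable section

namespace Graph

variable {α β : Type*}

/-! ### Cuts of a multigraph -/

/-- The edges of `G` with exactly one end in `S`. -/
def cutEdges (G : Graph α β) (S : Set α) : Set β :=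
  {e | ∃ x ∈ S, ∃ y ∉ S, G.IsLink e x y}

/-- `C` is a cut: the set of edges crossing a bipartition of the vertices into two
nonempty sides. (In a connected graph the edge set determines the bipartition.) -/
def IsCut (G : Graph α β) (C : Set β) : Prop :=
  ∃ S : Set α, S ⊆ G.vertexSet ∧ S.Nonempty ∧ S ≠ G.vertexSet ∧ C = G.cutEdges S

/-- The value `λ` of a minimum cut. -/
def minCut (G : Graph α β) : ℕ :=
  sInf {k | ∃ C, G.IsCut C ∧ k = C.ncard}

/-- `S` is the `u`-side of a minimum `(u, v)`-cut of `G`. -/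
def IsMinSepCut (G : Graph α β) (u v : α) (S : Set α) : Prop :=
  (S ⊆ G.vertexSet ∧ u ∈ S ∧ v ∉ S) ∧
    ∀ S' ⊆ G.vertexSet, u ∈ S' → v ∉ S' → (G.cutEdges S).ncard ≤ (G.cutEdges S').ncard

/-! ### Gomory–Hu trees -/

/-- The value, in the graph `T` with edge weights `w`, of the cut with side `S`. -/
def weightedCut {W : Type*} [Fintype W] (T : SimpleGraph W) (w : Sym2 W → ℕ) (S : Set W) : ℕ :=
  ∑ e ∈ T.edgeFinset with ∃ x ∈ S, ∃ y ∉ S, e = s(x, y), w e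

/-- The tree `T` on the vertex set of `G`, with edge weights `w`, is a Gomory–Hu tree of `G`:
for every two vertices `u`, `v`, some minimum `(u, v)`-cut of the weighted tree has the same
bipartition and the same value as a minimum `(u, v)`-cut of `G`. -/
def IsGomoryHuTree [Fintype α] (G : Graph α β) (T : SimpleGraph G.vertexSet)
    (w : Sym2 G.vertexSet → ℕ) : Prop :=
  T.IsTree ∧ ∀ u v : G.vertexSet, u ≠ v → ∃ S : Set G.vertexSet,
    (u ∈ S ∧ v ∉ S ∧
      ∀ S' : Set G.vertexSet, u ∈ S' → v ∉ S' → weightedCut T w S ≤ weightedCut T w S') ∧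
    G.IsMinSepCut u v (Subtype.val '' S) ∧
    weightedCut T w S = (G.cutEdges (Subtype.val '' S)).ncard

/-- The values of the Gomory–Hu tree cuts (one for each tree edge), in increasing order. -/
def gomoryHuList [Fintype α] (G : Graph α β) (T : SimpleGraph G.vertexSet)
    (w : Sym2 G.vertexSet → ℕ) : List ℕ :=
  (T.edgeFinset.val.map w).sort (· ≤ ·)

/-- The numbers `c₁ ≤ … ≤ c_{n-1}` (the values of the Gomory–Hu tree cuts) and
`c_n = max {c_{n-1}, 1.1 λ}`, where `n` is the number of vertices. -/
def gomoryHuValue [Fintype α] (G : Graph α β) (T : SimpleGraph G.vertexSet)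
    (w : Sym2 G.vertexSet → ℕ) (j : ℕ) : ℝ :=
  if j < G.vertexSet.ncard then ((G.gomoryHuList T w).getD (j - 1) 0 : ℝ)
  else max ((G.gomoryHuList T w).getD (G.vertexSet.ncard - 2) 0 : ℝ) (1.1 * G.minCut)

/-! ### Contraction levels -/

/-- `⌊log₂ log₂ n⌋`. -/
def logLog (n : ℕ) : ℕ := ⌊Real.logb 2 (Real.logb 2 n)⌋₊

/-- `k₀ = 1`, `k_i = ⌊n^{1 - 2^{-i}}⌋` for `1 ≤ i ≤ log log n`, and `k_{log log n + 1} = n`. -/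
def levelIndex (n i : ℕ) : ℕ :=
  if i = 0 then 1
  else if i ≤ logLog n then ⌊(n : ℝ) ^ (1 - (2 : ℝ)⁻¹ ^ i)⌋₊
  else n

/-- The `c`-connected component of `u`: all vertices that no cut with fewer than `c` edges
separates from `u`. -/
def connComponent (G : Graph α β) (c : ℝ) (u : α) : Set α :=
  {v ∈ G.vertexSet | ∀ S ⊆ G.vertexSet, u ∈ S → v ∉ S → c ≤ (G.cutEdges S).ncard}

/-- The graph obtained from `G` by contracting every `c`-connected component to one vertex
(which is the component itself, as a set) and deleting the loops. The remaining edges keep their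
names. -/
def contract (G : Graph α β) (c : ℝ) : Graph (Set α) β :=
  (G.map (G.connComponent c)).restrict {e | ∀ X, ¬ (G.map (G.connComponent c)).IsLoopAt e X}

/-- The contracted graph `G_i`. -/
def levelGraph [Fintype α] (G : Graph α β) (T : SimpleGraph G.vertexSet)
    (w : Sym2 G.vertexSet → ℕ) (i : ℕ) : Graph (Set α) β :=
  G.contract (G.gomoryHuValue T w (levelIndex G.vertexSet.ncard i))

/-! ### Greedy tree packings -/

/-- `F` is the edge set of a spanning tree of `G`. -/
def IsSpanningTree (G : Graph α β) (F : Set β) : Prop :=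
  F ⊆ G.edgeSet ∧ (G.restrict F).Simple ∧ (G.restrict F).toSimpleGraph.IsTree

/-- `F` is a minimum spanning tree of `G` for the edge weights `ℓ`. -/
def IsMinSpanningTree [Fintype β] (G : Graph α β) (ℓ : β → ℝ) (F : Set β) : Prop :=
  G.IsSpanningTree F ∧ ∀ F', G.IsSpanningTree F' → ∑ e with e ∈ F, ℓ e ≤ ∑ e with e ∈ F', ℓ e

/-- The load that a family of `k` trees induces on the edge `e`: the fraction of the trees that
contain `e` (and `0` for the empty family). -/
def load {k : ℕ} (𝒯 : Fin k → Set β) (e : β) : ℝ :=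
  ((Finset.univ.filter fun j => e ∈ 𝒯 j).card : ℝ) / k

/-- `𝒯` is the output of `N` rounds of greedy tree packing on `G`: each tree is a minimum
spanning tree for the loads induced by the trees before it (ties are broken arbitrarily). -/
def IsGreedyPacking [Fintype β] (G : Graph α β) {N : ℕ} (𝒯 : Fin N → Set β) : Prop :=
  ∀ i : Fin N, G.IsMinSpanningTree
    (load fun j : Fin i.val => 𝒯 (Fin.castLE i.isLt.le j)) (𝒯 i)

/-! ### The sampler and the likelihood ratio -/

/-- The probability that two independent uniform edges `e`, `f` of the spanning tree `F` of `H`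
define the cut `C`, that is, that `C` is the cut of `H` whose edges in `F` are exactly `e`
and `f`. It is `0` if `H` has one vertex, when there are no edges to sample and the sampler returns
no cut. -/
def twoEdgeProb [Fintype β] (H : Graph α β) (F C : Set β) : ℝ :=
  ((Finset.univ.filter fun x : β × β =>
      x.1 ∈ F ∧ x.2 ∈ F ∧ H.IsCut C ∧ C ∩ F = {x.1, x.2}).card : ℝ) / (F.ncard : ℝ) ^ 2

/-- The probability `q(C)` that the sampler returns the cut `C`: it picks a uniform one among the
`L` levels, at level `i` a uniform one among the `r i` sampled trees `S i j` of `H i`, and two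
independent uniform edges of this tree. -/
def sampleProb [Fintype β] {L : ℕ} (H : Fin L → Graph α β) {r : Fin L → ℕ}
    (S : ∀ i, Fin (r i) → Set β) (C : Set β) : ℝ :=
  (1 / (L : ℝ)) * ∑ i, (1 / (r i : ℝ)) * ∑ j, twoEdgeProb (H i) (S i j) C

/-- `z'_G(p)`, the expected number of failed cuts among those with fewer than `1.1 λ` edges. -/
def nearMinCutSum [Fintype β] (G : Graph α β) (p : ℝ) : ℝ :=
  ∑ C : Set β with G.IsCut C ∧ (C.ncard : ℝ) < 1.1 * G.minCut, p ^ C.ncard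

/-- The likelihood ratio `p^{|C|} / (q(C) z'_G(p))` of a cut `C` under the sampling
probabilities `q`. -/
def likelihoodRatio [Fintype β] (G : Graph α β) (p : ℝ) (q : Set β → ℝ) (C : Set β) : ℝ :=
  p ^ C.ncard / (q C * G.nearMinCutSum p)

/-- The probability of the event `A` for a uniformly random element of the finite type `Ω`. -/
def uniformProb {Ω : Type*} [Fintype Ω] (A : Ω → Prop) : ℝ :=
  ((Finset.univ.filter A).card : ℝ) / Fintype.card Ω

end Graph

end

/-!
Write `λ` for the minimum cut value of `G`; it is positive because `p ^ λ < n ^ (-1000) < 1`.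

**Greedy packings cross near-minimum cuts rarely.** Let `H` be a graph all of whose cuts have at
least `λ` edges, and `F` a minimum spanning tree of `H` for some edge weights. For every threshold
`s`, deleting the edges of weight at least `s` from `F` leaves parts that are joined in `H` by edges
of weight at least `s` only, by the cut property of minimum spanning trees. At least `λ` edges leave
each part and each edge leaves at most two parts, so `F` has at most `2 / λ` times as many edges of
weight at least `s` as `H` (`IsSpanningTree.ncard_mul_le`). Summation over the thresholds shows that
`∑ e ∈ F, a ^ (load of e)` is at most `2 / λ` times the sum over all the edges of `H`. So the
potential `∑ e, a ^ (number of trees containing e)` grows by a factor of at most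
`1 + 2 (a - 1) / λ` with each greedy tree. With `a = 5 / 4` and sufficiently many trees, no edge is
in more than a `2.2501 / λ` fraction of the trees (`IsGreedyPacking.treeCount_mul_le`). A cut of
fewer than `1.1 λ` edges then meets the trees in fewer than `2.476` edges on average and in at least
one edge always, so at least a quarter of the trees have at most two edges in it
(`IsGreedyPacking.le_four_mul_card`). As a tree and at most two of its edges determine the cut,
there are also at most `4 n ^ 2` such cuts (`IsGreedyPacking.card_nearMinCuts_le`).

**Levels.** For a cut `C` of fewer than `1.1 λ` edges take the first level `i` at which `C` survives
the contraction. The graph `G_i` has at most `k_i` vertices, because the Gomory–Hu tree edges of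
value less than `c_{k_i}` connect its vertices. At the level before it, `C` has at least
`c_{k_{i-1}}` edges, and the Gomory–Hu tree edges of at most this value give `k_{i-1}` different
cuts, whence `z' ≥ k_{i-1} p ^ |C|` (`IsGomoryHuTree.exists_level`). If a sampled tree of level `i`
has at most two edges in `C`, then `q(C)` is at least `1 / ((Λ + 1) r_i k_i ^ 2)`, and the
likelihood ratio is at most `(Λ + 1) r_i k_i ^ 2 / k_{i-1}`. This is `O(n)` up to logarithmic
factors, since `k_i ^ 2 ≤ 8 n k_{i-1}` (`levelIndex_succ_sq_le`).

**Probability.** With `r_i ≥ 4 (d + 4) log n` sampled trees, the probability that none of them has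
at most two edges in `C` is at most `(3 / 4) ^ r_i ≤ n ^ (-(d + 4))`, and a union bound over the at
most `4 n ^ 2` cuts finishes the proof.
-/

namespace Graph

section SpanningTrees

variable {γ β : Type*} {H : Graph γ β} {F : Set β} {e f : β} {S S' : Set γ} {x y : γ}

/-! ### Spanning trees and the cuts they cross -/

lemma IsLink.mem_cutEdges_iff (h : H.IsLink e x y) :
    e ∈ H.cutEdges S ↔ ¬ (x ∈ S ↔ y ∈ S) := by
  constructor
  · rintro ⟨a, ha, b, hb, hab⟩
    obtain ⟨rfl, rfl⟩ | ⟨rfl, rfl⟩ := h.eq_and_eq_or_eq_and_eq hab <;> tauto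
  · intro hxy
    by_cases hx : x ∈ S
    · exact ⟨x, hx, y, by tauto, h⟩
    · exact ⟨y, by tauto, x, hx, h.symm⟩

lemma cutEdges_subset_edgeSet : H.cutEdges S ⊆ H.edgeSet := by
  rintro e ⟨x, -, y, -, h⟩
  exact h.edge_mem

lemma cutEdges_compl : H.cutEdges Sᶜ = H.cutEdges S := by
  ext e
  constructor
  · rintro ⟨x, hx, y, hy, h⟩
    exact ⟨y, by simpa using hy, x, hx, h.symm⟩
  · rintro ⟨x, hx, y, hy, h⟩
    exact ⟨y, hy, x, by simpa using hx, h.symm⟩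

/-- The edge set `F` contains an edge of every cut, that is, it connects all the vertices. The
sides of the cuts are arbitrary sets, not necessarily subsets of the vertex set, so that
complements and unions of sides can be taken freely. -/
def MeetsCuts (H : Graph γ β) (F : Set β) : Prop :=
  ∀ ⦃S : Set γ⦄ ⦃x y : γ⦄, x ∈ H.vertexSet → y ∈ H.vertexSet → x ∈ S → y ∉ S →
    (F ∩ H.cutEdges S).Nonempty

lemma MeetsCuts.connected_toSimpleGraph (hF : H.MeetsCuts F) (hV : H.vertexSet.Nonempty) :
    (H.restrict F).toSimpleGraph.Connected := by
  have : Nonempty (H.restrict F).vertexSet := hV.to_subtype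
  refine ⟨fun u v => ?_⟩
  by_contra huv
  obtain ⟨e, heF, a, ⟨ha, hua⟩, b, hb, hab⟩ :=
    hF (S := {z | ∃ hz : z ∈ (H.restrict F).vertexSet,
      (H.restrict F).toSimpleGraph.Reachable u ⟨z, hz⟩}) u.2 v.2 ⟨u.2, .rfl⟩
      (fun ⟨_, h⟩ => huv h)
  refine hb ⟨hab.right_mem, hua.trans (SimpleGraph.Adj.reachable ⟨?_, e, heF, hab⟩)⟩
  rintro h
  obtain rfl : a = b := congrArg Subtype.val h
  exact hb ⟨ha, hua⟩

lemma meetsCuts_of_connected_toSimpleGraph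
    (h : (H.restrict F).toSimpleGraph.Connected) : H.MeetsCuts F := by
  intro S x y hx hy hxS hyS
  obtain ⟨p⟩ := h.preconnected ⟨x, hx⟩ ⟨y, hy⟩
  obtain ⟨d, -, h1, h2⟩ := p.exists_boundary_dart (Subtype.val ⁻¹' S) hxS hyS
  obtain ⟨-, e, heF, he⟩ := d.adj
  exact ⟨e, heF, _, h1, _, h2, he⟩

/-- Every edge of the simple graph underlying `H.restrict F` can be lifted to an edge in `F`. -/
lemma exists_injective_lift_edgeSet (H : Graph γ β) (F : Set β) :
    ∃ φ : (H.restrict F).toSimpleGraph.edgeSet → F, Function.Injective φ ∧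
      ∀ a (x y : H.vertexSet), a.1 = s(x, y) → H.IsLink (φ a) x y := by
  have key : ∀ a : (H.restrict F).toSimpleGraph.edgeSet, ∃ e : F,
      ∀ x y : H.vertexSet, a.1 = s(x, y) → H.IsLink e x y := by
    rintro ⟨a, ha⟩
    induction a using Sym2.ind with
    | _ u v =>
    obtain ⟨-, e, heF, he⟩ := ha
    refine ⟨⟨e, heF⟩, fun x y hxy => ?_⟩
    obtain ⟨rfl, rfl⟩ | ⟨rfl, rfl⟩ := Sym2.eq_iff.1 hxy
    exacts [he, he.symm]
  choose φ hφ using key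
  refine ⟨φ, ?_, hφ⟩
  rintro ⟨a, ha⟩ ⟨b, hb⟩ hab
  induction a using Sym2.ind with
  | _ u v =>
  induction b using Sym2.ind with
  | _ u' v' =>
  have h1 := hφ ⟨s(u, v), ha⟩ u v rfl
  have h2 := hφ ⟨s(u', v'), hb⟩ u' v' rfl
  rw [hab] at h1
  ext1
  obtain ⟨h, h'⟩ | ⟨h, h'⟩ := h1.eq_and_eq_or_eq_and_eq h2
  · exact Sym2.eq_iff.2 (Or.inl ⟨Subtype.ext h, Subtype.ext h'⟩)
  · exact Sym2.eq_iff.2 (Or.inr ⟨Subtype.ext h, Subtype.ext h'⟩)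

lemma MeetsCuts.ncard_vertexSet_le [Finite β] (hF : H.MeetsCuts F) :
    H.vertexSet.ncard ≤ F.ncard + 1 := by
  obtain hV | hV := H.vertexSet.eq_empty_or_nonempty
  · simp [hV]
  obtain ⟨φ, hφ, -⟩ := H.exists_injective_lift_edgeSet F
  have h1 := (hF.connected_toSimpleGraph hV).card_vert_le_card_edgeSet_add_one
  have h2 := Nat.card_le_card_of_injective φ hφ
  rw [← Nat.card_coe_set_eq, ← Nat.card_coe_set_eq]
  exact h1.trans (Nat.add_le_add_right h2 1)

/-- Spanning trees are the connecting edge sets with one edge fewer than there are vertices. -/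
lemma isSpanningTree_iff [Finite γ] [Finite β] : H.IsSpanningTree F ↔
    F ⊆ H.edgeSet ∧ H.vertexSet.Nonempty ∧ H.MeetsCuts F ∧ F.ncard + 1 = H.vertexSet.ncard := by
  have hfin : Finite (H.restrict F).vertexSet := Subtype.finite
  obtain ⟨φ, hφ, hlink⟩ := H.exists_injective_lift_edgeSet F
  constructor
  · rintro ⟨hFE, hs, ht⟩
    have hm := meetsCuts_of_connected_toSimpleGraph ht.connected
    refine ⟨hFE, ?_, hm, ?_⟩
    · obtain ⟨v⟩ := ht.connected.nonempty
      exact ⟨v, v.2⟩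
    have hc : Nat.card (H.restrict F).toSimpleGraph.edgeSet + 1 = H.vertexSet.ncard := by
      rw [(SimpleGraph.isTree_iff_connected_and_card.1 ht).2, ← Nat.card_coe_set_eq]
      rfl
    have hsurj : Function.Surjective φ := by
      rintro ⟨f, hf⟩
      obtain ⟨x, y, hxy⟩ := H.exists_isLink_of_mem_edgeSet (hFE hf)
      have hr : (H.restrict F).IsLink f x y := ⟨hf, hxy⟩
      let a : (H.restrict F).toSimpleGraph.edgeSet :=
        ⟨s(⟨x, hxy.left_mem⟩, ⟨y, hxy.right_mem⟩),
          fun h => hr.ne (congrArg Subtype.val h), f, hr⟩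
      refine ⟨a, Subtype.ext ?_⟩
      exact IsLink.eq (G := H.restrict F)
        ⟨(φ a).2, hlink a ⟨x, hxy.left_mem⟩ ⟨y, hxy.right_mem⟩ rfl⟩ hr
    rw [← hc, Nat.card_congr (Equiv.ofBijective φ ⟨hφ, hsurj⟩), Nat.card_coe_set_eq]
  · rintro ⟨hFE, hV, hm, hc⟩
    have hconn := hm.connected_toSimpleGraph hV
    have h1 := hconn.card_vert_le_card_edgeSet_add_one
    have h2 := Nat.card_le_card_of_injective φ hφ
    have h3 : Nat.card (H.restrict F).vertexSet = H.vertexSet.ncard := Nat.card_coe_set_eq _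
    rw [Nat.card_coe_set_eq F] at h2
    have hsurj : Function.Surjective φ :=
      (hφ.bijective_of_nat_card_le (by rw [Nat.card_coe_set_eq F]; omega)).2
    have hlift : ∀ e ∈ F, ∃ a : (H.restrict F).toSimpleGraph.edgeSet, (φ a : β) = e :=
      fun e he => (hsurj ⟨e, he⟩).imp fun a ha => by rw [ha]
    have hends : ∀ a : (H.restrict F).toSimpleGraph.edgeSet, ∀ x y, H.IsLink (φ a) x y →
        x ≠ y ∧ ∀ (hx : x ∈ H.vertexSet) (hy : y ∈ H.vertexSet), a.1 = s(⟨x, hx⟩, ⟨y, hy⟩) := by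
      rintro ⟨a, ha⟩ x y hxy
      induction a using Sym2.ind with
      | _ u v =>
      have hne : u ≠ v := ha.1
      obtain ⟨rfl, rfl⟩ | ⟨rfl, rfl⟩ :=
        (hlink ⟨s(u, v), ha⟩ u v rfl).eq_and_eq_or_eq_and_eq hxy
      · exact ⟨fun h => hne (Subtype.ext h), fun _ _ => rfl⟩
      · exact ⟨fun h => hne (Subtype.ext h.symm), fun _ _ => Sym2.eq_swap⟩
    refine ⟨hFE, { not_isLoopAt := ?_, eq_of_isLink := ?_ },
      SimpleGraph.isTree_iff_connected_and_card.2 ⟨hconn, ?_⟩⟩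
    · rintro e x ⟨heF, hx⟩
      obtain ⟨a, rfl⟩ := hlift e heF
      exact (hends a x x hx).1 rfl
    · rintro e f x y ⟨heF, he⟩ ⟨hfF, hf⟩
      obtain ⟨a, rfl⟩ := hlift e heF
      obtain ⟨b, rfl⟩ := hlift f hfF
      rw [Subtype.ext (((hends a x y he).2 he.left_mem he.right_mem).trans
        ((hends b x y hf).2 he.left_mem he.right_mem).symm)]
    · omega

lemma MeetsCuts.separates_iff (hF : H.MeetsCuts F)
    (h : F ∩ H.cutEdges S = F ∩ H.cutEdges S') (hx : x ∈ H.vertexSet) (hy : y ∈ H.vertexSet) :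
    (x ∈ S ↔ y ∈ S) ↔ (x ∈ S' ↔ y ∈ S') := by
  -- No edge of `F` crosses the set of vertices on which the two sides agree.
  have hD : ∀ x ∈ H.vertexSet, ∀ y ∈ H.vertexSet,
      x ∈ {v | v ∈ S ↔ v ∈ S'} → y ∈ {v | v ∈ S ↔ v ∈ S'} := by
    intro x hx y hy hxD
    by_contra hyD
    obtain ⟨g, hgF, a, ha, b, hb, hab⟩ := hF hx hy hxD hyD
    have := Set.ext_iff.1 h g
    simp only [Set.mem_inter_iff, hgF, true_and, hab.mem_cutEdges_iff] at this
    simp only [Set.mem_ofPred_eq] at ha hb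
    tauto
  have h1 := hD x hx y hy
  have h2 := hD y hy x hx
  simp only [Set.mem_ofPred_eq] at h1 h2
  tauto

/-- A connecting edge set determines the whole cut from its own edges in the cut. -/
lemma MeetsCuts.cutEdges_eq (hF : H.MeetsCuts F)
    (h : F ∩ H.cutEdges S = F ∩ H.cutEdges S') : H.cutEdges S = H.cutEdges S' := by
  ext g
  by_cases hg : g ∈ H.edgeSet
  · obtain ⟨a, b, hab⟩ := H.exists_isLink_of_mem_edgeSet hg
    rw [hab.mem_cutEdges_iff, hab.mem_cutEdges_iff,
      hF.separates_iff h hab.left_mem hab.right_mem]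
  · exact ⟨fun h => absurd (cutEdges_subset_edgeSet h) hg,
      fun h => absurd (cutEdges_subset_edgeSet h) hg⟩

/-- Every edge `f` of a spanning tree is the only tree edge in some cut, and the side of this
cut can be chosen not to contain a given vertex. -/
lemma IsSpanningTree.exists_inter_cutEdges_eq_singleton [Finite γ] [Finite β]
    (hF : H.IsSpanningTree F) (hf : f ∈ F) (r : γ) :
    ∃ S, r ∉ S ∧ F ∩ H.cutEdges S = {f} := by
  obtain ⟨-, -, hm, hc⟩ := isSpanningTree_iff.1 hF
  have hnot : ¬ H.MeetsCuts (F \ {f}) := by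
    intro h
    have h1 := h.ncard_vertexSet_le
    have h2 := Set.ncard_sdiff_singleton_add_one hf (Set.toFinite F)
    omega
  simp only [MeetsCuts, not_forall] at hnot
  obtain ⟨S, x, y, hx, hy, hxS, hyS, hne⟩ := hnot
  have hS : F ∩ H.cutEdges S = {f} := by
    obtain ⟨g, hg⟩ := hm hx hy hxS hyS
    have key : ∀ g ∈ F ∩ H.cutEdges S, g = f := by
      intro g hg
      by_contra hgf
      exact hne ⟨g, ⟨hg.1, hgf⟩, hg.2⟩
    obtain rfl := key g hg
    exact Set.eq_singleton_iff_unique_mem.2 ⟨hg, key⟩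
  by_cases hr : r ∈ S
  · exact ⟨Sᶜ, by simpa using hr, by rw [cutEdges_compl, hS]⟩
  · exact ⟨S, hr, hS⟩

lemma IsSpanningTree.exchange [Finite γ] [Finite β] (hF : H.IsSpanningTree F)
    (hS : F ∩ H.cutEdges S = {f}) (he : e ∈ H.cutEdges S) :
    H.IsSpanningTree (insert e (F \ {f})) := by
  obtain ⟨hFE, hV, hm, hc⟩ := isSpanningTree_iff.1 hF
  have hf : f ∈ F ∩ H.cutEdges S := hS ▸ rfl
  have heF : e ∉ F \ {f} := fun h => h.2 (hS ▸ (⟨h.1, he⟩ : e ∈ F ∩ H.cutEdges S))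
  refine isSpanningTree_iff.2 ⟨?_, hV, ?_, ?_⟩
  · exact Set.insert_subset (cutEdges_subset_edgeSet he) (Set.sdiff_subset.trans hFE)
  · intro S' x y hx hy hxS hyS
    by_cases h : ∃ g ∈ F ∩ H.cutEdges S', g ≠ f
    · obtain ⟨g, hg, hgf⟩ := h
      exact ⟨g, Or.inr ⟨hg.1, hgf⟩, hg.2⟩
    · push Not at h
      have hS' : F ∩ H.cutEdges S' = {f} := by
        obtain ⟨g, hg⟩ := hm hx hy hxS hyS
        obtain rfl := h g hg
        exact Set.eq_singleton_iff_unique_mem.2 ⟨hg, h⟩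
      rw [← hm.cutEdges_eq (hS.trans hS'.symm)]
      exact ⟨e, Or.inl rfl, he⟩
  · rw [Set.ncard_insert_of_notMem heF (Set.toFinite _),
      Set.ncard_sdiff_singleton_add_one hf.1 (Set.toFinite F), hc]

/-- The cut property: in the cut that a minimum spanning tree meets in the single edge `f`, no
edge is lighter than `f`. -/
lemma IsMinSpanningTree.weight_le [Finite γ] [Fintype β] {ℓ : β → ℝ}
    (hF : H.IsMinSpanningTree ℓ F) (hS : F ∩ H.cutEdges S = {f}) (he : e ∈ H.cutEdges S) :
    ℓ f ≤ ℓ e := by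
  have hf : f ∈ F ∩ H.cutEdges S := hS ▸ rfl
  have heF : e ∉ F \ {f} := fun h => h.2 (hS ▸ (⟨h.1, he⟩ : e ∈ F ∩ H.cutEdges S))
  obtain ⟨F', hF'⟩ : ∃ F', F' = insert e (F \ {f}) := ⟨_, rfl⟩
  have h := hF.2 F' (hF' ▸ hF.1.exchange hS he)
  have h1 : (Finset.univ.filter fun g => g ∈ F) =
      insert f (Finset.univ.filter fun g => g ∈ F \ {f}) := by
    ext g
    have := hf.1
    by_cases hg : g = f <;> simp [hg, this]
  have h2 : (Finset.univ.filter fun g => g ∈ F') =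
      insert e (Finset.univ.filter fun g => g ∈ F \ {f}) := by
    ext g
    simp [hF']
  rw [h1, h2, Finset.sum_insert (by simp), Finset.sum_insert (by simpa using heF)] at h
  linarith

/-- Let `D` be a set of edges of the spanning tree `F`, and let `X` contain all edges of `H` in
the fundamental cuts of the edges in `D`. Deleting `D` from the tree leaves `D.ncard + 1` parts.
Each edge that leaves a part is in `X`, each part is left by at least `c` edges, and each edge
leaves at most two of the parts. The parts used here are those of the lower ends of the edges in
`D`, for a root `r` of the tree. -/
lemma IsSpanningTree.ncard_mul_le [Finite γ] [Fintype β] (hF : H.IsSpanningTree F) {c : ℕ}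
    (hc : ∀ S : Set γ, ∀ x ∈ H.vertexSet, ∀ y ∈ H.vertexSet, x ∈ S → y ∉ S →
      c ≤ (H.cutEdges S).ncard)
    {D X : Set β} (hD : D ⊆ F)
    (hX : ∀ f ∈ D, ∀ S, F ∩ H.cutEdges S = {f} → H.cutEdges S ⊆ X) :
    D.ncard * c ≤ X.ncard * 2 := by
  obtain ⟨hFE, ⟨r, hr⟩, hm, -⟩ := isSpanningTree_iff.1 hF
  have hex : ∀ f : β, ∃ (S : Set γ) (x y : γ), f ∈ D →
      r ∉ S ∧ F ∩ H.cutEdges S = {f} ∧ x ∉ S ∧ y ∈ S ∧ H.IsLink f x y := by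
    intro f
    by_cases hf : f ∈ D
    · obtain ⟨S, hrS, hS⟩ := hF.exists_inter_cutEdges_eq_singleton (hD hf) r
      have hfS : f ∈ F ∩ H.cutEdges S := hS ▸ rfl
      obtain ⟨y, hy, x, hx, h⟩ := hfS.2
      exact ⟨S, x, y, fun _ => ⟨hrS, hS, hx, hy, h.symm⟩⟩
    · exact ⟨∅, r, r, fun h => absurd h hf⟩
  choose S x y hSxy using hex
  let P : β → Set γ := fun f => {v | ∀ g ∈ D, v ∈ S g ↔ y f ∈ S g}
  have hdisj : ∀ f ∈ D, ∀ g ∈ D, ∀ v, v ∈ P f → v ∈ P g → f = g := by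
    intro f hf g hg v hvf hvg
    by_contra hne
    have hfg : ∀ h ∈ D, y f ∈ S h ↔ y g ∈ S h := fun h hh => (hvf h hh).symm.trans (hvg h hh)
    obtain ⟨hrf, hSf, hxf, hyf, hlf⟩ := hSxy f hf
    obtain ⟨hrg, hSg, hxg, hyg, hlg⟩ := hSxy g hg
    have hxf' : x f ∈ S g := by
      by_contra hx
      have : f ∈ F ∩ H.cutEdges (S g) := by
        refine ⟨hD hf, hlf.mem_cutEdges_iff.2 ?_⟩
        have := (hfg g hg).2 hyg
        tauto
      rw [hSg] at this
      exact hne this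
    have hxg' : x g ∈ S f := by
      by_contra hx
      have : g ∈ F ∩ H.cutEdges (S f) := by
        refine ⟨hD hg, hlg.mem_cutEdges_iff.2 ?_⟩
        have := (hfg f hf).1 hyf
        tauto
      rw [hSf] at this
      exact hne this.symm
    -- The union of the two sides misses the root, but no tree edge leaves it.
    obtain ⟨h, hhF, a, ha, b, hb, hab⟩ := hm (S := S f ∪ S g) hlf.right_mem hr (Or.inl hyf)
      (by simp [hrf, hrg])
    simp only [Set.mem_union, not_or] at ha hb
    have hh : h = f ∨ h = g := by
      rcases ha with ha | ha
      · left
        have : h ∈ F ∩ H.cutEdges (S f) := ⟨hhF, a, ha, b, hb.1, hab⟩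
        rwa [hSf] at this
      · right
        have : h ∈ F ∩ H.cutEdges (S g) := ⟨hhF, a, ha, b, hb.2, hab⟩
        rwa [hSg] at this
    rcases hh with rfl | rfl
    · obtain ⟨rfl, rfl⟩ | ⟨rfl, rfl⟩ := hlf.eq_and_eq_or_eq_and_eq hab <;> tauto
    · obtain ⟨rfl, rfl⟩ | ⟨rfl, rfl⟩ := hlg.eq_and_eq_or_eq_and_eq hab <;> tauto
  have hPX : ∀ f, H.cutEdges (P f) ⊆ X := by
    rintro f e ⟨a, ha, b, hb, hab⟩
    have hb' : ∃ g ∈ D, ¬ (b ∈ S g ↔ y f ∈ S g) := by simpa [P] using hb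
    obtain ⟨g, hg, hbg⟩ := hb'
    refine hX g hg (S g) (hSxy g hg).2.1 (hab.mem_cutEdges_iff.2 ?_)
    have := ha g hg
    tauto
  rw [Set.ncard_eq_toFinset_card' D, Set.ncard_eq_toFinset_card' X]
  refine Finset.card_mul_le_card_mul (fun f e => e ∈ H.cutEdges (P f)) ?_ ?_
  · intro f hf
    rw [Set.mem_toFinset] at hf
    obtain ⟨hrf, -, -, hyf, hlf⟩ := hSxy f hf
    refine (hc (P f) (y f) hlf.right_mem r hr (fun _ _ => Iff.rfl)
      (fun h => hrf ((h f hf).2 hyf))).trans ?_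
    rw [Set.ncard_eq_toFinset_card']
    refine Finset.card_le_card fun e he => ?_
    rw [Set.mem_toFinset] at he
    simpa [Finset.bipartiteAbove] using ⟨hPX f he, he⟩
  · intro e _
    by_cases he : e ∈ H.edgeSet
    · obtain ⟨a, b, hab⟩ := H.exists_isLink_of_mem_edgeSet he
      have hsub : Finset.bipartiteBelow (fun f e => e ∈ H.cutEdges (P f)) D.toFinset e ⊆
          (D.toFinset.filter fun f => a ∈ P f) ∪ (D.toFinset.filter fun f => b ∈ P f) := by
        intro f hf
        simp only [Finset.bipartiteBelow, Finset.mem_filter, hab.mem_cutEdges_iff,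
          Finset.mem_union] at hf ⊢
        by_cases ha : a ∈ P f
        · exact Or.inl ⟨hf.1, ha⟩
        · exact Or.inr ⟨hf.1, by_contra fun hb => hf.2 (iff_of_false ha hb)⟩
      have hone : ∀ v, (D.toFinset.filter fun f => v ∈ P f).card ≤ 1 := by
        intro v
        refine Finset.card_le_one.2 fun f hf g hg => ?_
        simp only [Finset.mem_filter, Set.mem_toFinset] at hf hg
        exact hdisj f hf.1 g hg.1 v hf.2 hg.2
      calc _ ≤ _ := Finset.card_le_card hsub
        _ ≤ _ := Finset.card_union_le _ _
        _ ≤ 1 + 1 := add_le_add (hone a) (hone b)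
    · have : Finset.bipartiteBelow (fun f e => e ∈ H.cutEdges (P f)) D.toFinset e = ∅ := by
        refine Finset.filter_eq_empty_iff.2 fun f _ h => he (cutEdges_subset_edgeSet h)
      rw [this]
      simp

end SpanningTrees

section Packings

variable {γ β : Type*} {H : Graph γ β} {F C : Set β} {e f : β} {S : Set γ}

/-! ### Loads of a greedy tree packing -/

lemma pow_eq_one_add_sum (a : ℝ) {l M : ℕ} (h : l ≤ M) :
    a ^ l = 1 + ∑ s ∈ Finset.range M, if s + 1 ≤ l then (a - 1) * a ^ s else 0 := by
  rw [← Finset.sum_filter]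
  have : (Finset.range M).filter (fun s => s + 1 ≤ l) = Finset.range l := by
    ext s
    simp only [Finset.mem_filter, Finset.mem_range]
    omega
  rw [this, ← Finset.mul_sum, mul_comm, geom_sum_mul]
  ring

/-- If, for each threshold `s`, at most a `2 / c` fraction as many members of `F` as of `E` have
value at least `s`, the same bound holds for sums of the increasing function `a ^ ·`. -/
lemma sum_pow_mul_le {F E : Finset β} {L : β → ℕ} {c a : ℝ} (ha : 1 ≤ a)
    (h : ∀ s, ((F.filter fun e => s ≤ L e).card : ℝ) * c ≤ (E.filter fun e => s ≤ L e).card * 2) :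
    (∑ e ∈ F, a ^ L e) * c ≤ (∑ e ∈ E, a ^ L e) * 2 := by
  obtain ⟨M, hM⟩ : ∃ M, ∀ e ∈ F ∪ E, L e ≤ M :=
    ⟨(F ∪ E).sup L, fun e he => Finset.le_sup (f := L) he⟩
  have expand : ∀ Q ⊆ F ∪ E, ∑ e ∈ Q, a ^ L e = ((Q.filter fun e => 0 ≤ L e).card : ℝ) +
      ∑ s ∈ Finset.range M, (a - 1) * a ^ s * (Q.filter fun e => s + 1 ≤ L e).card := by
    intro Q hQ
    rw [Finset.sum_congr rfl fun e he => pow_eq_one_add_sum a (hM e (hQ he)),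
      Finset.sum_add_distrib, Finset.sum_comm]
    congr 1
    · simp
    · refine Finset.sum_congr rfl fun s _ => ?_
      rw [← Finset.sum_filter, Finset.sum_const, nsmul_eq_mul, mul_comm]
  rw [expand F Finset.subset_union_left, expand E Finset.subset_union_right, add_mul, add_mul,
    Finset.sum_mul, Finset.sum_mul]
  refine add_le_add (h 0) (Finset.sum_le_sum fun s _ => ?_)
  have : 0 ≤ (a - 1) * a ^ s := mul_nonneg (by linarith) (pow_nonneg (by linarith) _)
  rw [mul_assoc ((a - 1) * a ^ s), mul_assoc ((a - 1) * a ^ s)]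
  exact mul_le_mul_of_nonneg_left (h (s + 1)) this

/-- The number of trees containing `e` among the first `j` trees of the family. -/
noncomputable def treeCount {N : ℕ} (𝒯 : Fin N → Set β) (j : ℕ) (e : β) : ℕ :=
  (Finset.univ.filter fun i : Fin N => i.val < j ∧ e ∈ 𝒯 i).card

lemma treeCount_zero {N : ℕ} (𝒯 : Fin N → Set β) (e : β) : treeCount 𝒯 0 e = 0 := by
  simp [treeCount]

lemma treeCount_succ {N : ℕ} (𝒯 : Fin N → Set β) (i : Fin N) (e : β) :
    treeCount 𝒯 (i + 1) e = treeCount 𝒯 i e + if e ∈ 𝒯 i then 1 else 0 := by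
  have hi : ∀ j : Fin N, j.val < i + 1 ↔ j.val < i ∨ j = i := by
    intro j
    rw [Fin.ext_iff]
    omega
  unfold treeCount
  split_ifs with h
  · rw [← Finset.card_insert_of_notMem (a := i) (by simp)]
    congr 1
    ext j
    simp only [Finset.mem_filter, Finset.mem_univ, true_and, Finset.mem_insert, hi]
    constructor
    · rintro ⟨hj | rfl, h'⟩
      · exact Or.inr ⟨hj, h'⟩
      · exact Or.inl rfl
    · rintro (rfl | ⟨hj, h'⟩)
      · exact ⟨Or.inr rfl, h⟩
      · exact ⟨Or.inl hj, h'⟩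
  · rw [add_zero]
    congr 1
    ext j
    simp only [Finset.mem_filter, Finset.mem_univ, true_and, hi]
    constructor
    · rintro ⟨hj | rfl, h'⟩
      · exact ⟨hj, h'⟩
      · exact absurd h' h
    · rintro ⟨hj, h'⟩
      exact ⟨Or.inl hj, h'⟩

lemma load_castLE {N : ℕ} (𝒯 : Fin N → Set β) (i : Fin N) (e : β) :
    load (fun j : Fin i.val => 𝒯 (Fin.castLE i.isLt.le j)) e = (treeCount 𝒯 i e : ℝ) / i.val := by
  unfold load treeCount
  congr 2
  refine Finset.card_bij (fun j _ => Fin.castLE i.isLt.le j) ?_ ?_ ?_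
  · intro j hj
    exact Finset.mem_filter.2 ⟨Finset.mem_univ _, j.2, (Finset.mem_filter.1 hj).2⟩
  · intro j _ j' _ h
    simpa using h
  · intro j hj
    simp only [Finset.mem_filter, Finset.mem_univ, true_and] at hj
    exact ⟨⟨j, hj.1⟩, by simpa using hj.2, rfl⟩

lemma IsGreedyPacking.treeCount_le [Finite γ] [Fintype β] {N : ℕ} {𝒯 : Fin N → Set β}
    (h : H.IsGreedyPacking 𝒯) (i : Fin N) (hS : 𝒯 i ∩ H.cutEdges S = {f})
    (he : e ∈ H.cutEdges S) : treeCount 𝒯 i f ≤ treeCount 𝒯 i e := by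
  -- For the first tree all the loads have the form `0 / 0`, but all the counts are zero as well.
  obtain hi | hi := Nat.eq_zero_or_pos i.val
  · rw [hi, treeCount_zero, treeCount_zero]
  · have := (h i).weight_le hS he
    rw [load_castLE, load_castLE, div_le_div_iff_of_pos_right (by exact_mod_cast hi)] at this
    exact_mod_cast this

/-- The exponential potential `∑ e, a ^ (number of trees containing e)` grows by a factor of at
most `1 + 2 (a - 1) / c` with each greedy tree, if all cuts have at least `c` edges. -/
lemma IsGreedyPacking.sum_pow_treeCount_le [Finite γ] [Fintype β] {N : ℕ} {𝒯 : Fin N → Set β}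
    (h : H.IsGreedyPacking 𝒯) {c : ℕ} (hc0 : 0 < c)
    (hc : ∀ S : Set γ, ∀ x ∈ H.vertexSet, ∀ y ∈ H.vertexSet, x ∈ S → y ∉ S →
      c ≤ (H.cutEdges S).ncard) {a : ℝ} (ha : 1 ≤ a) {j : ℕ} (hj : j ≤ N) :
    ∑ e with e ∈ H.edgeSet, a ^ treeCount 𝒯 j e ≤
      H.edgeSet.ncard * (1 + 2 * (a - 1) / c) ^ j := by
  induction j with
  | zero =>
    simp only [treeCount_zero, pow_zero, Finset.sum_const, nsmul_eq_mul, mul_one]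
    rw [Set.ncard_eq_toFinset_card', Set.filter_mem_univ_eq_toFinset]
  | succ j ih =>
    have hc' : (0 : ℝ) < c := by exact_mod_cast hc0
    let i : Fin N := ⟨j, hj⟩
    have htree := (h i).1
    have hFE : 𝒯 i ⊆ H.edgeSet := htree.1
    have hthr : ∀ s, (((Finset.univ.filter (· ∈ 𝒯 i)).filter fun e => s ≤ treeCount 𝒯 j e).card
        : ℝ) * c ≤
        ((Finset.univ.filter (· ∈ H.edgeSet)).filter fun e => s ≤ treeCount 𝒯 j e).card * 2 := by
      intro s
      have := htree.ncard_mul_le hc (D := {e | e ∈ 𝒯 i ∧ s ≤ treeCount 𝒯 j e})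
        (X := {e | e ∈ H.edgeSet ∧ s ≤ treeCount 𝒯 j e}) (fun e he => he.1)
        (fun f hf S hS e he => ⟨cutEdges_subset_edgeSet he, hf.2.trans (h.treeCount_le i hS he)⟩)
      rw [Set.ncard_eq_toFinset_card', Set.ncard_eq_toFinset_card'] at this
      rw [Finset.filter_filter, Finset.filter_filter]
      simp only [Set.toFinset_ofPred] at this
      exact_mod_cast this
    have hstep : ∑ e with e ∈ H.edgeSet, a ^ treeCount 𝒯 (j + 1) e =
        ∑ e with e ∈ H.edgeSet, a ^ treeCount 𝒯 j e +
          (a - 1) * ∑ e with e ∈ 𝒯 i, a ^ treeCount 𝒯 j e := by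
      have : ∀ e, a ^ treeCount 𝒯 (j + 1) e = a ^ treeCount 𝒯 j e +
          if e ∈ 𝒯 i then (a - 1) * a ^ treeCount 𝒯 j e else 0 := by
        intro e
        rw [show treeCount 𝒯 (j + 1) e = _ from treeCount_succ 𝒯 i e]
        split_ifs
        · rw [pow_succ]
          ring
        · simp [i]
      rw [Finset.sum_congr rfl fun e _ => this e, Finset.sum_add_distrib, ← Finset.sum_filter,
        Finset.filter_filter, Finset.mul_sum]
      congr 2
      ext e
      simp only [Finset.mem_filter, Finset.mem_univ, true_and]
      exact ⟨fun h => h.2, fun h => ⟨hFE h, h⟩⟩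
    have hsum := sum_pow_mul_le (F := Finset.univ.filter (· ∈ 𝒯 i))
      (E := Finset.univ.filter (· ∈ H.edgeSet)) ha hthr
    have ih' := ih (by omega)
    set Φ := ∑ e with e ∈ H.edgeSet, a ^ treeCount 𝒯 j e
    set Ψ := ∑ e with e ∈ 𝒯 i, a ^ treeCount 𝒯 j e
    have hΨ : Ψ ≤ Φ * 2 / c := by rwa [le_div_iff₀ hc']
    have ha' : 0 ≤ a - 1 := by linarith
    calc _ = Φ + (a - 1) * Ψ := hstep
      _ ≤ Φ + (a - 1) * (Φ * 2 / c) := by gcongr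
      _ = Φ * (1 + 2 * (a - 1) / c) := by ring
      _ ≤ (H.edgeSet.ncard * (1 + 2 * (a - 1) / c) ^ j) * (1 + 2 * (a - 1) / c) := by
          gcongr
      _ = _ := by ring

/-- In a greedy packing of sufficiently many trees on a graph without cuts of fewer than `c`
edges, no edge is in much more than a `2 / c` fraction of the trees. -/
lemma IsGreedyPacking.treeCount_mul_le [Finite γ] [Fintype β] {N : ℕ} {𝒯 : Fin N → Set β}
    (h : H.IsGreedyPacking 𝒯) {c : ℕ} (hc0 : 0 < c)
    (hc : ∀ S : Set γ, ∀ x ∈ H.vertexSet, ∀ y ∈ H.vertexSet, x ∈ S → y ∉ S →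
      c ≤ (H.cutEdges S).ncard)
    {ε : ℝ} (hε0 : 0 < ε) (hε : ε ≤ 0.01)
    (hN : 6 * c * Real.log H.edgeSet.ncard / ε ^ 2 ≤ N) (he : e ∈ H.edgeSet) :
    (treeCount 𝒯 N e : ℝ) * c ≤ 2.2501 * N := by
  have hc' : (0 : ℝ) < c := by exact_mod_cast hc0
  have hm : (0 : ℝ) < H.edgeSet.ncard := by
    exact_mod_cast (Set.ncard_pos (Set.toFinite _)).2 ⟨e, he⟩
  -- Up to the term `log m / N` for `m` edges, base `a` gives the bound `2 * (a - 1) / (c * log a)`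
  -- on the fraction of trees. At `a = 5 / 4` it is less than `2.25 / c`.
  have h1 := h.sum_pow_treeCount_le hc0 hc (a := 5 / 4) (by norm_num) le_rfl
  have h2 : (5 / 4 : ℝ) ^ treeCount 𝒯 N e ≤
      ∑ e with e ∈ H.edgeSet, (5 / 4 : ℝ) ^ treeCount 𝒯 N e :=
    Finset.single_le_sum (f := fun e => (5 / 4 : ℝ) ^ treeCount 𝒯 N e)
      (fun _ _ => by positivity) (by simpa using he)
  have h3 := Real.log_le_log (by positivity) (h2.trans h1)
  have hpos : (0 : ℝ) < 1 + 2 * (5 / 4 - 1) / c := by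
    have : (0 : ℝ) ≤ 2 * (5 / 4 - 1) / c := by positivity
    linarith
  rw [Real.log_pow, Real.log_mul hm.ne' (pow_pos hpos _).ne', Real.log_pow] at h3
  have h4 : Real.log (1 + 2 * (5 / 4 - 1) / c) ≤ 2 * (5 / 4 - 1) / c := by
    have := Real.log_le_sub_one_of_pos hpos
    linarith
  have h5 : (2 / 9 : ℝ) ≤ Real.log (5 / 4) := by
    have := Real.le_log_one_add_of_nonneg (x := 1 / 4) (by norm_num)
    norm_num at this ⊢
    exact this
  have h6 : c * Real.log H.edgeSet.ncard ≤ N * 0.0001 / 6 := by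
    rw [div_le_iff₀ (by positivity)] at hN
    have : ε ^ 2 ≤ 0.0001 := by nlinarith
    have : (N : ℝ) * ε ^ 2 ≤ N * 0.0001 := by gcongr
    linarith
  have h7 : (treeCount 𝒯 N e : ℝ) * (2 / 9) ≤
      Real.log H.edgeSet.ncard + N * (2 * (5 / 4 - 1) / c) :=
    calc _ ≤ (treeCount 𝒯 N e : ℝ) * Real.log (5 / 4) := by gcongr
      _ ≤ _ := h3
      _ ≤ _ := by gcongr
  have h8 : (treeCount 𝒯 N e : ℝ) * (2 / 9) * c ≤
      c * Real.log H.edgeSet.ncard + N * (1 / 2) :=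
    calc _ ≤ (Real.log H.edgeSet.ncard + N * (2 * (5 / 4 - 1) / c)) * c := by gcongr
      _ = _ := by
        field_simp
        ring
  have hN0 : (0 : ℝ) ≤ N := Nat.cast_nonneg N
  linarith

lemma IsCut.exists_mem_not_mem (hC : H.IsCut C) : ∃ S x y,
    x ∈ H.vertexSet ∧ y ∈ H.vertexSet ∧ x ∈ S ∧ y ∉ S ∧ C = H.cutEdges S := by
  obtain ⟨S, hSV, ⟨x, hx⟩, hne, rfl⟩ := hC
  obtain ⟨y, hyV, hyS⟩ := Set.exists_of_ssubset (hSV.ssubset_of_ne hne)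
  exact ⟨S, x, y, hSV hx, hyV, hx, hyS, rfl⟩

/-- Each tree meets each cut, and on average the trees have fewer than `1.1 * 2.2501` edges in a
cut of fewer than `1.1 * c` edges. So at least a quarter of them have at most two edges in it. -/
lemma IsGreedyPacking.le_four_mul_card [Finite γ] [Fintype β] {N : ℕ} {𝒯 : Fin N → Set β}
    (h : H.IsGreedyPacking 𝒯) {c : ℕ} (hc0 : 0 < c)
    (hc : ∀ S : Set γ, ∀ x ∈ H.vertexSet, ∀ y ∈ H.vertexSet, x ∈ S → y ∉ S →
      c ≤ (H.cutEdges S).ncard)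
    {ε : ℝ} (hε0 : 0 < ε) (hε : ε ≤ 0.01)
    (hN : 6 * c * Real.log H.edgeSet.ncard / ε ^ 2 ≤ N)
    (hC : H.IsCut C) (hCc : (C.ncard : ℝ) < 1.1 * c) :
    (N : ℝ) ≤ 4 * (Finset.univ.filter fun j => (C ∩ 𝒯 j).ncard ≤ 2).card := by
  have hc' : (0 : ℝ) < c := by exact_mod_cast hc0
  obtain ⟨S, x, y, hx, hy, hxS, hyS, rfl⟩ := hC.exists_mem_not_mem
  have hmeet : ∀ j, 1 ≤ (H.cutEdges S ∩ 𝒯 j).ncard := by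
    intro j
    rw [Nat.one_le_iff_ne_zero, Set.inter_comm]
    exact ((Set.ncard_pos (Set.toFinite _)).2
      ((isSpanningTree_iff.1 (h j).1).2.2.1 hx hy hxS hyS)).ne'
  have hswap : ∑ j, (H.cutEdges S ∩ 𝒯 j).ncard =
      ∑ e with e ∈ H.cutEdges S, treeCount 𝒯 N e := by
    have h1 : ∀ j, (H.cutEdges S ∩ 𝒯 j).ncard =
        ∑ e with e ∈ H.cutEdges S, if e ∈ 𝒯 j then 1 else 0 := by
      intro j
      rw [Finset.sum_boole, Finset.filter_filter, Set.ncard_eq_toFinset_card']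
      simp only [Nat.cast_id]
      congr 1
      ext e
      simp
    rw [Finset.sum_congr rfl fun j _ => h1 j, Finset.sum_comm]
    refine Finset.sum_congr rfl fun e _ => ?_
    rw [Finset.sum_boole, treeCount]
    simp
  have hupper : (∑ j, ((H.cutEdges S ∩ 𝒯 j).ncard : ℝ)) * c ≤ 1.1 * c * (2.2501 * N) := by
    calc (∑ j, ((H.cutEdges S ∩ 𝒯 j).ncard : ℝ)) * c
        = ∑ e with e ∈ H.cutEdges S, (treeCount 𝒯 N e : ℝ) * c := by
          rw [← Finset.sum_mul]
          exact_mod_cast congrArg (fun k : ℕ => (k : ℝ) * c) hswap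
      _ ≤ ∑ e with e ∈ H.cutEdges S, 2.2501 * (N : ℝ) := by
          refine Finset.sum_le_sum fun e he => ?_
          exact h.treeCount_mul_le hc0 hc hε0 hε hN
            (cutEdges_subset_edgeSet (Finset.mem_filter.1 he).2)
      _ = (H.cutEdges S).ncard * (2.2501 * N) := by
          rw [Finset.sum_const, nsmul_eq_mul, Set.ncard_eq_toFinset_card',
            Set.filter_mem_univ_eq_toFinset]
      _ ≤ _ := by gcongr
  have hlower : 3 * (N : ℝ) ≤ ∑ j, ((H.cutEdges S ∩ 𝒯 j).ncard : ℝ) +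
      2 * (Finset.univ.filter fun j => (H.cutEdges S ∩ 𝒯 j).ncard ≤ 2).card := by
    have h1 : ∀ j, (3 : ℝ) ≤ ((H.cutEdges S ∩ 𝒯 j).ncard : ℝ) +
        2 * if (H.cutEdges S ∩ 𝒯 j).ncard ≤ 2 then 1 else 0 := by
      intro j
      split_ifs with h2
      · have : (1 : ℝ) ≤ (H.cutEdges S ∩ 𝒯 j).ncard := by exact_mod_cast hmeet j
        linarith
      · have : (3 : ℝ) ≤ (H.cutEdges S ∩ 𝒯 j).ncard := by
          exact_mod_cast (by omega : 3 ≤ (H.cutEdges S ∩ 𝒯 j).ncard)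
        linarith
    have h2 := Finset.sum_le_sum fun j (_ : j ∈ Finset.univ) => h1 j
    rw [Finset.sum_add_distrib, ← Finset.mul_sum, Finset.sum_boole] at h2
    simp only [Finset.sum_const, Finset.card_univ, Fintype.card_fin, nsmul_eq_mul] at h2
    linarith
  have hupper' : (∑ j, ((H.cutEdges S ∩ 𝒯 j).ncard : ℝ)) ≤ 1.1 * (2.2501 * N) := by
    refine le_of_mul_le_mul_right ?_ hc'
    linarith
  have hN0 : (0 : ℝ) ≤ N := Nat.cast_nonneg N
  linarith

end Packings

section Contraction

variable {α β : Type*} {G : Graph α β} {C : Set β} {e : β} {S : Set α} {u v x y : α} {c : ℝ}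

/-! ### Cuts of a contracted graph -/

lemma cutEdges_vertexSet_inter : G.cutEdges (G.vertexSet ∩ S) = G.cutEdges S := by
  ext e
  constructor
  · rintro ⟨x, hx, y, hy, h⟩
    exact ⟨x, hx.2, y, fun hyS => hy ⟨h.right_mem, hyS⟩, h⟩
  · rintro ⟨x, hx, y, hy, h⟩
    exact ⟨x, ⟨h.left_mem, hx⟩, y, fun hyS => hy hyS.2, h⟩

lemma isCut_cutEdges (hx : x ∈ G.vertexSet) (hy : y ∈ G.vertexSet) (hxS : x ∈ S) (hyS : y ∉ S) :
    G.IsCut (G.cutEdges S) :=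
  ⟨G.vertexSet ∩ S, Set.inter_subset_left, ⟨x, hx, hxS⟩,
    fun h => hyS (h.symm.subset hy).2, cutEdges_vertexSet_inter.symm⟩

lemma IsCut.minCut_le (hC : G.IsCut C) : G.minCut ≤ C.ncard :=
  Nat.sInf_le ⟨C, hC, rfl⟩

lemma minCut_le_ncard_cutEdges (hx : x ∈ G.vertexSet) (hy : y ∈ G.vertexSet) (hxS : x ∈ S)
    (hyS : y ∉ S) : G.minCut ≤ (G.cutEdges S).ncard :=
  (isCut_cutEdges hx hy hxS hyS).minCut_le

lemma meetsCuts_edgeSet_of_minCut_pos (h : 0 < G.minCut) : G.MeetsCuts G.edgeSet := by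
  intro S x y hx hy hxS hyS
  rw [Set.inter_eq_right.2 cutEdges_subset_edgeSet]
  exact Set.nonempty_of_ncard_ne_zero
    (h.trans_le (minCut_le_ncard_cutEdges hx hy hxS hyS)).ne'

lemma mem_connComponent_self (hu : u ∈ G.vertexSet) : u ∈ G.connComponent c u :=
  ⟨hu, fun _ _ h h' => absurd h h'⟩

lemma connComponent_eq_of_mem (hu : u ∈ G.vertexSet) (h : v ∈ G.connComponent c u) :
    G.connComponent c u = G.connComponent c v := by
  -- The complementary side of a cut separating `v` from `u` separates `u` from `v`.
  have hsymm : ∀ S ⊆ G.vertexSet, v ∈ S → u ∉ S → c ≤ (G.cutEdges S).ncard := by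
    intro S _ hv hu'
    have := h.2 (G.vertexSet ∩ Sᶜ) Set.inter_subset_left ⟨hu, hu'⟩ (fun h' => h'.2 hv)
    rwa [cutEdges_vertexSet_inter, cutEdges_compl] at this
  ext z
  constructor
  · rintro ⟨hz, hz'⟩
    refine ⟨hz, fun S hS hv hzS => ?_⟩
    by_cases huS : u ∈ S
    · exact hz' S hS huS hzS
    · exact hsymm S hS hv huS
  · rintro ⟨hz, hz'⟩
    refine ⟨hz, fun S hS hu hzS => ?_⟩
    by_cases hvS : v ∈ S
    · exact hz' S hS hvS hzS
    · exact h.2 S hS hu hvS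

lemma contract_isLink {X Y : Set α} : (G.contract c).IsLink e X Y ↔
    X ≠ Y ∧ ∃ x y, G.IsLink e x y ∧ G.connComponent c x = X ∧ G.connComponent c y = Y := by
  constructor
  · rintro ⟨hloop, hlink⟩
    refine ⟨?_, hlink⟩
    rintro rfl
    exact hloop X hlink
  · rintro ⟨hne, hlink⟩
    refine ⟨fun Z hZ => hne ?_, hlink⟩
    have h : (G.map (G.connComponent c)).IsLink e X Y := hlink
    obtain ⟨rfl, rfl⟩ | ⟨rfl, rfl⟩ := h.eq_and_eq_or_eq_and_eq hZ <;> rfl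

lemma cutEdges_contract (𝒮 : Set (Set α)) :
    (G.contract c).cutEdges 𝒮 = G.cutEdges (G.connComponent c ⁻¹' 𝒮) := by
  ext e
  constructor
  · rintro ⟨X, hX, Y, hY, h⟩
    obtain ⟨-, x, y, hxy, rfl, rfl⟩ := contract_isLink.1 h
    exact ⟨x, hX, y, hY, hxy⟩
  · rintro ⟨x, hx, y, hy, h⟩
    exact ⟨_, hx, _, hy, contract_isLink.2
      ⟨fun h' => hy ((congrArg (· ∈ 𝒮) h').mp hx), x, y, h, rfl, rfl⟩⟩

lemma minCut_le_ncard_cutEdges_contract (𝒮 : Set (Set α)) :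
    ∀ X ∈ (G.contract c).vertexSet, ∀ Y ∈ (G.contract c).vertexSet, X ∈ 𝒮 → Y ∉ 𝒮 →
      G.minCut ≤ ((G.contract c).cutEdges 𝒮).ncard := by
  rintro _ ⟨x, hx, rfl⟩ _ ⟨y, hy, rfl⟩ hX hY
  rw [cutEdges_contract]
  exact minCut_le_ncard_cutEdges hx hy hX hY

/-- Cuts with fewer than `c` edges survive the contraction of the `c`-connected components. -/
lemma IsCut.contract (hC : G.IsCut C) (h : (C.ncard : ℝ) < c) : (G.contract c).IsCut C := by
  obtain ⟨S, hSV, ⟨x, hx⟩, hne, rfl⟩ := hC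
  obtain ⟨y, hyV, hyS⟩ := Set.exists_of_ssubset (hSV.ssubset_of_ne hne)
  have hS : ∀ v ∈ G.vertexSet, G.connComponent c v ∈ G.connComponent c '' S → v ∈ S := by
    rintro v hv ⟨s, hs, hsv⟩
    by_contra hvS
    have : v ∈ G.connComponent c s := hsv ▸ mem_connComponent_self hv
    exact h.not_ge (this.2 S hSV hs hvS)
  have hcut : (G.contract c).cutEdges (G.connComponent c '' S) = G.cutEdges S := by
    rw [cutEdges_contract, ← cutEdges_vertexSet_inter]
    congr 1
    ext v
    exact ⟨fun hv => hS v hv.1 hv.2, fun hv => ⟨hSV hv, Set.mem_image_of_mem _ hv⟩⟩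
  rw [← hcut]
  exact isCut_cutEdges (x := G.connComponent c x) (y := G.connComponent c y)
    ⟨x, hSV hx, rfl⟩ ⟨y, hyV, rfl⟩ ⟨x, hx, rfl⟩ (fun h' => hyS (hS y hyV h'))

/-! ### The sum over the near-minimum cuts -/

lemma IsCut.pow_le_nearMinCutSum [Fintype β] (hC : G.IsCut C)
    (hCc : (C.ncard : ℝ) < 1.1 * G.minCut) {p : ℝ} (hp0 : 0 < p) :
    p ^ C.ncard ≤ G.nearMinCutSum p :=
  Finset.single_le_sum (f := fun C : Set β => p ^ C.ncard) (fun _ _ => by positivity)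
    (Finset.mem_filter.2 ⟨Finset.mem_univ _, hC, hCc⟩)

lemma card_mul_pow_le_nearMinCutSum [Fintype β] {p : ℝ} (hp0 : 0 < p) (hp1 : p < 1)
    (hCc : (C.ncard : ℝ) < 1.1 * G.minCut) {ι : Type*} {D : Finset ι} {φ : ι → Set β}
    (hφ : Set.InjOn φ D) (hD : ∀ i ∈ D, G.IsCut (φ i) ∧ (φ i).ncard ≤ C.ncard) :
    D.card * p ^ C.ncard ≤ G.nearMinCutSum p :=
  calc (D.card : ℝ) * p ^ C.ncard = ∑ i ∈ D, p ^ C.ncard := by rw [Finset.sum_const, nsmul_eq_mul]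
    _ ≤ ∑ i ∈ D, p ^ (φ i).ncard :=
        Finset.sum_le_sum fun i hi => pow_le_pow_of_le_one hp0.le hp1.le (hD i hi).2
    _ = ∑ C' ∈ D.image φ, p ^ C'.ncard := 
        (Finset.sum_image (f := fun C : Set β => p ^ C.ncard) hφ).symm
    _ ≤ G.nearMinCutSum p := by
        refine Finset.sum_le_sum_of_subset_of_nonneg ?_ fun _ _ _ => by positivity
        intro C' hC'
        obtain ⟨i, hi, rfl⟩ := Finset.mem_image.1 hC'
        exact Finset.mem_filter.2 ⟨Finset.mem_univ _, (hD i hi).1,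
          lt_of_le_of_lt (Nat.cast_le.2 (hD i hi).2) hCc⟩

/-! ### Gomory–Hu trees -/

variable [Fintype α] {T : SimpleGraph G.vertexSet} {w : Sym2 G.vertexSet → ℕ}

/-- For adjacent vertices `a`, `b` of a tree, some side of a cut contains `a` but not `b`, and
`s(a, b)` is the only tree edge in this cut. -/
lemma exists_side_of_isTree {W : Type*} {T : SimpleGraph W} (hT : T.IsTree) {a b : W}
    (hab : T.Adj a b) : ∃ S : Set W, a ∈ S ∧ b ∉ S ∧
      ∀ e ∈ T.edgeSet, (∃ x ∈ S, ∃ y ∉ S, e = s(x, y)) → e = s(a, b) := by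
  have hbr := SimpleGraph.isAcyclic_iff_forall_adj_isBridge.1 hT.isAcyclic hab
  rw [SimpleGraph.isBridge_iff] at hbr
  refine ⟨{z | (T.deleteEdges {s(a, b)}).Reachable a z}, .rfl, hbr, ?_⟩
  rintro e he ⟨x, hx, y, hy, rfl⟩
  by_contra hne
  exact hy (hx.trans (SimpleGraph.Adj.reachable
    (SimpleGraph.deleteEdges_adj.2 ⟨he, by simpa using hne⟩)))

lemma weightedCut_le {W : Type*} [Fintype W] {T : SimpleGraph W} {w : Sym2 W → ℕ} {S : Set W}
    {e₀ : Sym2 W} (h : ∀ e ∈ T.edgeSet, (∃ x ∈ S, ∃ y ∉ S, e = s(x, y)) → e = e₀) :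
    weightedCut T w S ≤ w e₀ := by
  rw [← Finset.sum_singleton w e₀, weightedCut]
  refine Finset.sum_le_sum_of_subset fun e he => ?_
  rw [Finset.mem_filter, SimpleGraph.mem_edgeFinset] at he
  exact Finset.mem_singleton.2 (h e he.1 he.2)

lemma sum_le_weightedCut {W : Type*} [Fintype W] {T : SimpleGraph W} {w : Sym2 W → ℕ} {S : Set W}
    {D : Finset (Sym2 W)} (h : ∀ e ∈ D, e ∈ T.edgeSet ∧ ∃ x ∈ S, ∃ y ∉ S, e = s(x, y)) :
    ∑ e ∈ D, w e ≤ weightedCut T w S := by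
  refine Finset.sum_le_sum_of_subset fun e he => ?_
  rw [Finset.mem_filter, SimpleGraph.mem_edgeFinset]
  exact h e he

/-- For every tree edge there is a minimum cut of `G` between its ends that has the tree edge as
its only tree edge, provided that `G` is connected. Indeed, all weights of tree edges are then
positive. -/
lemma IsGomoryHuTree.exists_side (hT : G.IsGomoryHuTree T w) (hG : 0 < G.minCut)
    {a b : G.vertexSet} (hab : T.Adj a b) : ∃ S : Set G.vertexSet, a ∈ S ∧ b ∉ S ∧
      (∀ e ∈ T.edgeSet, (∃ x ∈ S, ∃ y ∉ S, e = s(x, y)) → e = s(a, b)) ∧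
      G.IsMinSepCut a b (Subtype.val '' S) ∧
      w s(a, b) = (G.cutEdges (Subtype.val '' S)).ncard := by
  have key : ∀ a b : G.vertexSet, T.Adj a b → ∃ S : Set G.vertexSet, a ∈ S ∧ b ∉ S ∧
      G.IsMinSepCut a b (Subtype.val '' S) ∧ weightedCut T w S = w s(a, b) ∧
      w s(a, b) = (G.cutEdges (Subtype.val '' S)).ncard := by
    intro a b hab
    obtain ⟨S, ⟨ha, hb, hmin⟩, hsep, hval⟩ := hT.2 a b hab.ne
    obtain ⟨S', ha', hb', huniq⟩ := exists_side_of_isTree hT.1 hab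
    have h1 : weightedCut T w S' ≤ w s(a, b) := weightedCut_le huniq
    have h2 : w s(a, b) ≤ weightedCut T w S := by
      rw [← Finset.sum_singleton w s(a, b)]
      refine sum_le_weightedCut fun e he => ?_
      rw [Finset.mem_singleton.1 he]
      exact ⟨hab, a, ha, b, hb, rfl⟩
    have h3 := le_antisymm ((hmin S' ha' hb').trans h1) h2
    exact ⟨S, ha, hb, hsep, h3, h3.symm.trans hval⟩
  have hpos : ∀ e ∈ T.edgeSet, 0 < w e := by
    intro e he
    induction e using Sym2.ind with
    | _ x y =>
    obtain ⟨S, hx, hy, -, -, h⟩ := key x y he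
    rw [h]
    exact hG.trans_le (minCut_le_ncard_cutEdges x.2 y.2 ⟨x, hx, rfl⟩ (by simpa using hy))
  obtain ⟨S, ha, hb, hsep, hw, hval⟩ := key a b hab
  refine ⟨S, ha, hb, fun e he hcross => ?_, hsep, hval⟩
  by_contra hne
  have h1 : w s(a, b) + w e ≤ weightedCut T w S := by
    rw [← Finset.sum_pair (f := w) (Ne.symm hne)]
    refine sum_le_weightedCut fun e' he' => ?_
    rw [Finset.mem_insert, Finset.mem_singleton] at he'
    rcases he' with rfl | rfl
    · exact ⟨hab, a, ha, b, hb, rfl⟩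
    · exact ⟨he, hcross⟩
  have := hpos e he
  omega

/-- The tree edges of weight less than `c` connect the `c`-connected components. -/
lemma IsGomoryHuTree.ncard_vertexSet_contract_le (hT : G.IsGomoryHuTree T w)
    (hG : 0 < G.minCut) (c : ℝ) : (G.contract c).vertexSet.ncard ≤
      (T.edgeFinset.filter fun e => (w e : ℝ) < c).card + 1 := by
  let Q : Graph (Set α) (Sym2 G.vertexSet) :=
    (ofSimpleGraph T).map fun v => G.connComponent c v.1
  have hQ : Q.MeetsCuts {e | e ∈ T.edgeSet ∧ (w e : ℝ) < c} := by
    rintro 𝒮 _ _ ⟨u, -, rfl⟩ ⟨v, -, rfl⟩ huS hvS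
    obtain ⟨q⟩ := hT.1.connected.preconnected u v
    obtain ⟨d, -, h1, h2⟩ := q.exists_boundary_dart {z | G.connComponent c z.1 ∈ 𝒮} huS hvS
    refine ⟨s(d.fst, d.snd), ⟨d.adj, ?_⟩, _, h1, _, h2, d.fst, d.snd, ?_, rfl, rfl⟩
    · by_contra hw
      have hmem : d.snd.1 ∈ G.connComponent c d.fst.1 := by
        refine ⟨d.snd.2, fun S hS hf hs => ?_⟩
        obtain ⟨S', -, -, -, hmin, hval⟩ := hT.exists_side hG d.adj
        refine (not_lt.1 hw).trans ?_
        rw [hval]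
        exact_mod_cast hmin.2 S hS hf hs
      refine h2 ?_
      rw [Set.mem_ofPred_eq, ← connComponent_eq_of_mem d.fst.2 hmem]
      exact h1
    · have hadj := d.adj
      simp [ofSimpleGraph, hadj]
  have hV : Q.vertexSet = (G.contract c).vertexSet := by
    ext X
    constructor
    · rintro ⟨v, -, rfl⟩
      exact ⟨v, v.2, rfl⟩
    · rintro ⟨v, hv, rfl⟩
      exact ⟨⟨v, hv⟩, Set.mem_univ _, rfl⟩
  have h := hQ.ncard_vertexSet_le
  rw [hV] at h
  refine h.trans (Nat.add_le_add_right (le_of_eq ?_) 1)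
  rw [← Set.ncard_coe_finset]
  congr 1
  ext e
  simp

/-- Different tree edges yield different cuts of `G`. -/
lemma IsGomoryHuTree.exists_cuts (hT : G.IsGomoryHuTree T w) (hG : 0 < G.minCut) :
    ∃ φ : Sym2 G.vertexSet → Set β, Set.InjOn φ T.edgeSet ∧
      ∀ e ∈ T.edgeSet, G.IsCut (φ e) ∧ (φ e).ncard = w e := by
  have hex : ∀ e : Sym2 G.vertexSet, ∃ S : Set G.vertexSet, e ∈ T.edgeSet →
      (∃ x ∈ S, ∃ y ∉ S, e = s(x, y)) ∧
      (∀ e' ∈ T.edgeSet, (∃ x ∈ S, ∃ y ∉ S, e' = s(x, y)) → e' = e) ∧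
      w e = (G.cutEdges (Subtype.val '' S)).ncard := by
    intro e
    induction e using Sym2.ind with
    | _ a b =>
    by_cases hab : T.Adj a b
    · obtain ⟨S, ha, hb, huniq, -, hval⟩ := hT.exists_side hG hab
      exact ⟨S, fun _ => ⟨⟨a, ha, b, hb, rfl⟩, huniq, hval⟩⟩
    · exact ⟨∅, fun h => absurd h hab⟩
  choose S hS using hex
  refine ⟨fun e => G.cutEdges (Subtype.val '' S e), ?_, ?_⟩
  · intro e he f hf hef
    obtain ⟨⟨x, hx, y, hy, hexy⟩, -, -⟩ := hS e he
    obtain ⟨-, huniq, -⟩ := hS f hf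
    refine huniq e he ?_
    have := (meetsCuts_edgeSet_of_minCut_pos hG).separates_iff
      (congrArg (G.edgeSet ∩ ·) hef) x.2 y.2
    simp only [Subtype.val_injective.mem_set_image, hx, hy] at this
    by_cases hxf : x ∈ S f
    · exact ⟨x, hxf, y, by tauto, hexy⟩
    · exact ⟨y, by tauto, x, hxf, hexy.trans Sym2.eq_swap⟩
  · intro e he
    obtain ⟨⟨x, hx, y, hy, -⟩, -, hval⟩ := hS e he
    exact ⟨isCut_cutEdges x.2 y.2 ⟨x, hx, rfl⟩ (by simpa using hy), hval.symm⟩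

/-! ### The values of the Gomory–Hu tree cuts -/

lemma countP_lt_getElem_le {l : List ℕ} (hl : l.Pairwise (· ≤ ·)) {j : ℕ} (hj : j < l.length) :
    l.countP (fun x => x < l[j]) ≤ j := by
  have h := List.countP_append (p := fun x : ℕ => decide (x < l[j])) (l₁ := l.take j)
    (l₂ := l.drop j)
  rw [List.take_append_drop] at h
  have h1 := List.countP_le_length (p := fun x : ℕ => decide (x < l[j])) (l := l.take j)
  have h2 : (l.drop j).countP (fun x : ℕ => decide (x < l[j])) = 0 := by
    rw [List.countP_eq_zero]
    intro x hx
    obtain ⟨i, hi, rfl⟩ := List.getElem_of_mem hx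
    rw [List.getElem_drop]
    have : l[j] ≤ l[j + i]'(by rw [List.length_drop] at hi; omega) := by
      obtain rfl | h := Nat.eq_zero_or_pos i
      · simp
      · exact List.pairwise_iff_getElem.1 hl _ _ _ _ (by omega)
    simpa using this
  rw [h, h2, add_zero]
  exact h1.trans (by simp)

lemma lt_countP_le_of_getElem_le {l : List ℕ} (hl : l.Pairwise (· ≤ ·)) {j t : ℕ}
    (hj : j < l.length) (ht : l[j] ≤ t) : j < l.countP (fun x => x ≤ t) := by
  have h1 : (l.take (j + 1)).countP (fun x => x ≤ t) = j + 1 := by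
    rw [List.countP_eq_length.2, List.length_take]
    · omega
    · intro x hx
      obtain ⟨i, hi, rfl⟩ := List.getElem_of_mem hx
      rw [List.length_take] at hi
      rw [List.getElem_take]
      have : l[i] ≤ l[j] := by
        obtain rfl | h := eq_or_lt_of_le (by omega : i ≤ j)
        · simp
        · exact List.pairwise_iff_getElem.1 hl _ _ _ _ h
      simpa using this.trans ht
  have h2 := (List.take_sublist (j + 1) l).countP_le (p := fun x => decide (x ≤ t))
  omega

lemma countP_gomoryHuList (T : SimpleGraph G.vertexSet) (w : Sym2 G.vertexSet → ℕ)
    (P : ℕ → Prop) [DecidablePred P] :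
    (G.gomoryHuList T w).countP (fun x => P x) =
      (T.edgeFinset.filter fun e => P (w e)).card := by
  rw [← Multiset.coe_countP, gomoryHuList, Multiset.sort_eq, Multiset.countP_map]
  rfl

lemma length_gomoryHuList (hT : T.IsTree) :
    (G.gomoryHuList T w).length + 1 = G.vertexSet.ncard := by
  rw [gomoryHuList, Multiset.length_sort, Multiset.card_map, ← Nat.card_coe_set_eq,
    Nat.card_eq_fintype_card, ← hT.card_edgeFinset]
  rfl

lemma gomoryHuValue_of_lt (hT : T.IsTree) {k : ℕ} (hk : 1 ≤ k) (hkn : k < G.vertexSet.ncard) :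
    ∃ h : k - 1 < (G.gomoryHuList T w).length,
      G.gomoryHuValue T w k = ((G.gomoryHuList T w)[k - 1] : ℝ) := by
  have hlen := length_gomoryHuList (w := w) hT
  have h : k - 1 < (G.gomoryHuList T w).length := by omega
  refine ⟨h, ?_⟩
  rw [gomoryHuValue, if_pos hkn, List.getD_eq_getElem _ _ h]

lemma pairwise_gomoryHuList : (G.gomoryHuList T w).Pairwise (· ≤ ·) :=
  Multiset.pairwise_sort _ _

/-- There are at most `k` components that are `c_k`-connected. -/
lemma IsGomoryHuTree.ncard_vertexSet_contract_gomoryHuValue_le (hT : G.IsGomoryHuTree T w)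
    (hG : 0 < G.minCut) {k : ℕ} (hk : 1 ≤ k) (hkn : k ≤ G.vertexSet.ncard) :
    (G.contract (G.gomoryHuValue T w k)).vertexSet.ncard ≤ k := by
  obtain rfl | hlt := hkn.eq_or_lt
  · exact Set.ncard_image_le (Set.toFinite _)
  · refine (hT.ncard_vertexSet_contract_le hG _).trans ?_
    obtain ⟨h, hval⟩ := gomoryHuValue_of_lt (w := w) hT.1 hk hlt
    have h1 := countP_lt_getElem_le pairwise_gomoryHuList h
    rw [countP_gomoryHuList T w (fun x => x < (G.gomoryHuList T w)[k - 1])] at h1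
    simp only [hval, Nat.cast_lt]
    omega

/-- If a cut of fewer than `1.1 λ` edges has at least `c_k` edges, then at least `k` cuts
contribute at least as much as this cut to the sum over the cuts of fewer than `1.1 λ` edges. -/
lemma IsGomoryHuTree.mul_pow_le_nearMinCutSum [Fintype β] (hT : G.IsGomoryHuTree T w)
    (hG : 0 < G.minCut) {p : ℝ} (hp0 : 0 < p) (hp1 : p < 1)
    (hCc : (C.ncard : ℝ) < 1.1 * G.minCut) {k : ℕ} (hk : 1 ≤ k) (hkn : k < G.vertexSet.ncard)
    (hkC : G.gomoryHuValue T w k ≤ C.ncard) : k * p ^ C.ncard ≤ G.nearMinCutSum p := by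
  obtain ⟨φ, hφ, hcut⟩ := hT.exists_cuts hG
  obtain ⟨h, hval⟩ := gomoryHuValue_of_lt (w := w) hT.1 hk hkn
  rw [hval] at hkC
  have h1 := lt_countP_le_of_getElem_le pairwise_gomoryHuList h (t := C.ncard)
    (by exact_mod_cast hkC)
  rw [countP_gomoryHuList T w (fun x => x ≤ C.ncard)] at h1
  have hD : ∀ e ∈ T.edgeFinset.filter fun e => w e ≤ C.ncard, e ∈ T.edgeSet ∧ w e ≤ C.ncard := by
    intro e he
    rwa [Finset.mem_filter, SimpleGraph.mem_edgeFinset] at he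
  refine le_trans ?_ (card_mul_pow_le_nearMinCutSum hp0 hp1 hCc (hφ.mono fun e he => (hD e he).1)
    fun e he => ⟨(hcut e (hD e he).1).1, (hcut e (hD e he).1).2.trans_le (hD e he).2⟩)
  have h2 : k ≤ (T.edgeFinset.filter fun e => w e ≤ C.ncard).card := by omega
  exact mul_le_mul_of_nonneg_right (Nat.cast_le.2 h2) (pow_pos hp0 _).le

end Contraction

section Sampling

variable {γ β : Type*} {H : Graph γ β} {F C : Set β}

/-! ### Cuts with at most two edges in a tree -/

/-- The two elements may coincide, just as the two edges drawn by the sampler. -/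
lemma exists_eq_pair_of_ncard_le_two [Finite β] {A : Set β} (hne : A.Nonempty)
    (h : A.ncard ≤ 2) : ∃ e f, A = {e, f} := by
  have h0 := (Set.ncard_pos (Set.toFinite A)).2 hne
  obtain h1 | h2 : A.ncard = 1 ∨ A.ncard = 2 := by omega
  · obtain ⟨e, rfl⟩ := Set.ncard_eq_one.1 h1
    exact ⟨e, e, by simp⟩
  · obtain ⟨e, f, -, rfl⟩ := Set.ncard_eq_two.1 h2
    exact ⟨e, f, rfl⟩

lemma IsSpanningTree.inter_nonempty [Finite γ] [Finite β] (hF : H.IsSpanningTree F)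
    (hC : H.IsCut C) : (C ∩ F).Nonempty := by
  obtain ⟨S, x, y, hx, hy, hxS, hyS, rfl⟩ := hC.exists_mem_not_mem
  rw [Set.inter_comm]
  exact (isSpanningTree_iff.1 hF).2.2.1 hx hy hxS hyS

lemma IsSpanningTree.ncard_le [Finite γ] [Finite β] (hF : H.IsSpanningTree F) :
    F.ncard ≤ H.vertexSet.ncard := by
  have := (isSpanningTree_iff.1 hF).2.2.2
  omega

/-- A cut with at most two edges in a spanning tree is determined by these edges. -/
lemma IsSpanningTree.card_cuts_le [Finite γ] [Fintype β] (hF : H.IsSpanningTree F) :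
    (Finset.univ.filter fun C : Set β => H.IsCut C ∧ (C ∩ F).ncard ≤ 2).card ≤
      H.vertexSet.ncard ^ 2 := by
  have h1 : (Finset.univ.filter fun C : Set β => H.IsCut C ∧ (C ∩ F).ncard ≤ 2).card ≤
      ((F.toFinset ×ˢ F.toFinset).image fun z => ({z.1, z.2} : Set β)).card := by
    refine Finset.card_le_card_of_injOn (fun C => C ∩ F) ?_ ?_
    · intro C hC
      obtain ⟨hC, h2⟩ := (Finset.mem_filter.1 hC).2
      obtain ⟨e, f, hef⟩ := exists_eq_pair_of_ncard_le_two (hF.inter_nonempty hC) h2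
      have he : e ∈ C ∩ F := hef ▸ Set.mem_insert _ _
      have hf : f ∈ C ∩ F := hef ▸ Set.mem_insert_of_mem _ rfl
      exact Finset.mem_image.2 ⟨(e, f), by simp [he.2, hf.2], hef.symm⟩
    · intro C hC C' hC' h
      obtain ⟨S, -, -, -, -, -, -, rfl⟩ := (Finset.mem_filter.1 hC).2.1.exists_mem_not_mem
      obtain ⟨S', -, -, -, -, -, -, rfl⟩ := (Finset.mem_filter.1 hC').2.1.exists_mem_not_mem
      refine (isSpanningTree_iff.1 hF).2.2.1.cutEdges_eq ?_
      rw [Set.inter_comm, Set.inter_comm F]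
      exact h
  refine h1.trans (Finset.card_image_le.trans ?_)
  rw [Finset.card_product, ← Set.ncard_eq_toFinset_card', sq]
  exact Nat.mul_le_mul hF.ncard_le hF.ncard_le

/-- The number of near-minimum cuts is at most quadratic in the number of vertices: a tree has
at most two edges in at most `H.vertexSet.ncard ^ 2` cuts, but a near-minimum cut has this
property for a quarter of the trees of a greedy packing. -/
lemma IsGreedyPacking.card_nearMinCuts_le [Finite γ] [Fintype β] {N : ℕ} {𝒯 : Fin N → Set β}
    (h : H.IsGreedyPacking 𝒯) (hN0 : 0 < N) {c : ℕ} (hc0 : 0 < c)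
    (hc : ∀ S : Set γ, ∀ x ∈ H.vertexSet, ∀ y ∈ H.vertexSet, x ∈ S → y ∉ S →
      c ≤ (H.cutEdges S).ncard)
    {ε : ℝ} (hε0 : 0 < ε) (hε : ε ≤ 0.01)
    (hN : 6 * c * Real.log H.edgeSet.ncard / ε ^ 2 ≤ N) :
    ((Finset.univ.filter fun C : Set β => H.IsCut C ∧ (C.ncard : ℝ) < 1.1 * c).card : ℝ) ≤
      4 * (H.vertexSet.ncard : ℝ) ^ 2 := by
  have hN0' : (0 : ℝ) < N := by exact_mod_cast hN0
  set 𝒞 := Finset.univ.filter fun C : Set β => H.IsCut C ∧ (C.ncard : ℝ) < 1.1 * c with h𝒞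
  have h1 : ∑ C ∈ 𝒞, (Finset.univ.filter fun j => (C ∩ 𝒯 j).ncard ≤ 2).card ≤
      N * H.vertexSet.ncard ^ 2 := by
    calc _ = ∑ j, (𝒞.filter fun C => (C ∩ 𝒯 j).ncard ≤ 2).card :=
          Finset.sum_card_bipartiteAbove_eq_sum_card_bipartiteBelow _
      _ ≤ ∑ j : Fin N, H.vertexSet.ncard ^ 2 := by
          refine Finset.sum_le_sum fun j _ =>
            (Finset.card_le_card fun C hC => ?_).trans (h j).1.card_cuts_le
          simp only [h𝒞, Finset.mem_filter, Finset.mem_univ, true_and] at hC ⊢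
          exact ⟨hC.1.1, hC.2⟩
      _ = _ := by simp
  have h2 : (𝒞.card : ℝ) * N ≤
      4 * ∑ C ∈ 𝒞, ((Finset.univ.filter fun j => (C ∩ 𝒯 j).ncard ≤ 2).card : ℝ) := by
    rw [Finset.mul_sum, ← nsmul_eq_mul]
    refine Finset.card_nsmul_le_sum _ _ _ fun C hC => ?_
    obtain ⟨hC, hCc⟩ := (Finset.mem_filter.1 hC).2
    exact h.le_four_mul_card hc0 hc hε0 hε hN hC hCc
  have h3 : (∑ C ∈ 𝒞, ((Finset.univ.filter fun j => (C ∩ 𝒯 j).ncard ≤ 2).card : ℝ)) ≤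
      N * (H.vertexSet.ncard : ℝ) ^ 2 := by
    exact_mod_cast h1
  refine le_of_mul_le_mul_right ?_ hN0'
  linarith

lemma IsSpanningTree.one_div_le_twoEdgeProb [Finite γ] [Fintype β] (hF : H.IsSpanningTree F)
    (hC : H.IsCut C) (h : (C ∩ F).ncard ≤ 2) {k : ℕ} (hk : H.vertexSet.ncard ≤ k) :
    1 / (k : ℝ) ^ 2 ≤ twoEdgeProb H F C := by
  obtain ⟨e, f, hef⟩ := exists_eq_pair_of_ncard_le_two (hF.inter_nonempty hC) h
  have he : e ∈ C ∩ F := hef ▸ Set.mem_insert _ _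
  have hf : f ∈ C ∩ F := hef ▸ Set.mem_insert_of_mem _ rfl
  have hF0 : (0 : ℝ) < F.ncard := by
    exact_mod_cast (Set.ncard_pos (Set.toFinite F)).2 ⟨e, he.2⟩
  have hFk : (F.ncard : ℝ) ≤ k := by exact_mod_cast hF.ncard_le.trans hk
  have hone : (1 : ℝ) ≤ ((Finset.univ.filter fun x : β × β =>
      x.1 ∈ F ∧ x.2 ∈ F ∧ H.IsCut C ∧ C ∩ F = {x.1, x.2}).card : ℝ) := by
    exact Nat.one_le_cast.2 (Finset.card_pos.2
      ⟨(e, f), Finset.mem_filter.2 ⟨Finset.mem_univ _, he.2, hf.2, hC, hef⟩⟩)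
  unfold twoEdgeProb
  gcongr

lemma twoEdgeProb_nonneg [Fintype β] : 0 ≤ twoEdgeProb H F C := by
  unfold twoEdgeProb
  positivity

lemma one_div_le_sampleProb [Finite γ] [Fintype β] {L : ℕ} {H : Fin L → Graph γ β}
    {r : Fin L → ℕ} {S : ∀ i, Fin (r i) → Set β} {i : Fin L} {j : Fin (r i)}
    (hF : (H i).IsSpanningTree (S i j)) (hC : (H i).IsCut C) (h : (C ∩ S i j).ncard ≤ 2)
    {k : ℕ} (hk : (H i).vertexSet.ncard ≤ k) :
    1 / (L * r i * (k : ℝ) ^ 2) ≤ sampleProb H S C := by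
  have h1 : 1 / (k : ℝ) ^ 2 ≤ ∑ j, twoEdgeProb (H i) (S i j) C :=
    (hF.one_div_le_twoEdgeProb hC h hk).trans
      (Finset.single_le_sum (f := fun j => twoEdgeProb (H i) (S i j) C)
        (fun _ _ => twoEdgeProb_nonneg) (Finset.mem_univ j))
  have h2 : 1 / (r i : ℝ) * (1 / (k : ℝ) ^ 2) ≤
      ∑ i, (1 / (r i : ℝ)) * ∑ j, twoEdgeProb (H i) (S i j) C :=
    (mul_le_mul_of_nonneg_left h1 (by positivity)).trans
      (Finset.single_le_sum (f := fun i => (1 / (r i : ℝ)) * ∑ j, twoEdgeProb (H i) (S i j) C)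
        (fun i _ => mul_nonneg (by positivity)
          (Finset.sum_nonneg fun _ _ => twoEdgeProb_nonneg)) (Finset.mem_univ i))
  calc 1 / (L * r i * (k : ℝ) ^ 2) = 1 / (L : ℝ) * (1 / (r i : ℝ) * (1 / (k : ℝ) ^ 2)) := by
        rw [one_div_mul_one_div, one_div_mul_one_div, mul_assoc]
    _ ≤ _ := mul_le_mul_of_nonneg_left h2 (by positivity)

/-! ### Uniform probabilities -/

lemma uniformProb_eq {Ω : Type*} [Fintype Ω] (A : Ω → Prop) [DecidablePred A] :
    uniformProb A = ((Finset.univ.filter A).card : ℝ) / Fintype.card Ω := by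
  unfold uniformProb
  congr!

section Probability

variable {ι : Type*} [Fintype ι] [DecidableEq ι]

/-- An event that concerns one factor of a product has the same probability in the product. -/
lemma uniformProb_apply {Ω : ι → Type*} [∀ i, Fintype (Ω i)] [∀ i, Nonempty (Ω i)] (i : ι)
    (A : Ω i → Prop) : uniformProb (fun ω : ∀ i, Ω i => A (ω i)) = uniformProb A := by
  have h1 : (Finset.univ.filter fun ω : ∀ i, Ω i => A (ω i)) =
      Fintype.piFinset (Function.update (fun i => (Finset.univ : Finset (Ω i))) i
        (Finset.univ.filter A)) := by
    ext ω
    simp only [Finset.mem_filter, Finset.mem_univ, true_and, Fintype.mem_piFinset]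
    constructor
    · intro h j
      obtain rfl | hj := eq_or_ne j i
      · simpa using h
      · rw [Function.update_of_ne hj]
        exact Finset.mem_univ _
    · intro h
      simpa using h i
  have h2 : (Finset.univ.filter fun ω : ∀ i, Ω i => A (ω i)).card =
      (Finset.univ.filter A).card * ∏ j ∈ Finset.univ.erase i, Fintype.card (Ω j) := by
    rw [h1, Fintype.card_piFinset, ← Finset.mul_prod_erase _ _ (Finset.mem_univ i),
      Function.update_self]
    congr 1
    refine Finset.prod_congr rfl fun j hj => ?_
    rw [Function.update_of_ne (Finset.ne_of_mem_erase hj)]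
    rfl
  have h3 : Fintype.card (∀ i, Ω i) =
      Fintype.card (Ω i) * ∏ j ∈ Finset.univ.erase i, Fintype.card (Ω j) := by
    rw [Fintype.card_pi, ← Finset.mul_prod_erase _ _ (Finset.mem_univ i)]
  have h4 : (∏ j ∈ Finset.univ.erase i, Fintype.card (Ω j) : ℝ) ≠ 0 :=
    Finset.prod_ne_zero_iff.2 fun j _ => Nat.cast_ne_zero.2 Fintype.card_ne_zero
  unfold uniformProb
  rw [h2, h3]
  push_cast
  exact mul_div_mul_right _ _ h4

lemma uniformProb_forall {Ω : Type*} [Fintype Ω] (A : Ω → Prop) :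
    uniformProb (fun ω : ι → Ω => ∀ j, A (ω j)) = uniformProb A ^ Fintype.card ι := by
  have h1 : (Finset.univ.filter fun ω : ι → Ω => ∀ j, A (ω j)) =
      Fintype.piFinset fun _ => Finset.univ.filter A := by
    ext ω
    simp
  rw [uniformProb_eq, uniformProb_eq, h1, Fintype.card_piFinset, Finset.prod_const,
    Fintype.card_fun, Finset.card_univ]
  push_cast
  rw [div_pow]

/-- The union bound. -/
lemma one_sub_sum_le_uniformProb {Ω κ : Type*} [Fintype Ω] [Nonempty Ω] {A : Ω → Prop}
    (s : Finset κ) (bad : κ → Ω → Prop) (h : ∀ ω, (∀ k ∈ s, ¬ bad k ω) → A ω) :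
    1 - ∑ k ∈ s, uniformProb (bad k) ≤ uniformProb A := by
  have h0 : (0 : ℝ) < Fintype.card Ω := by exact_mod_cast Fintype.card_pos
  have h1 : Fintype.card Ω ≤ (Finset.univ.filter A).card +
      ∑ k ∈ s, (Finset.univ.filter (bad k)).card := by
    rw [← Finset.card_univ]
    refine (Finset.card_le_card (t := Finset.univ.filter A ∪
      s.biUnion fun k => Finset.univ.filter (bad k)) fun ω _ => ?_).trans
      ((Finset.card_union_le _ _).trans (Nat.add_le_add_left Finset.card_biUnion_le _))
    by_cases hω : ∀ k ∈ s, ¬ bad k ω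
    · exact Finset.mem_union_left _ (Finset.mem_filter.2 ⟨Finset.mem_univ _, h ω hω⟩)
    · push Not at hω
      obtain ⟨k, hk, hb⟩ := hω
      exact Finset.mem_union_right _ (Finset.mem_biUnion.2
        ⟨k, hk, Finset.mem_filter.2 ⟨Finset.mem_univ _, hb⟩⟩)
  have h2 : (Fintype.card Ω : ℝ) ≤ (Finset.univ.filter A).card +
      ∑ k ∈ s, ((Finset.univ.filter (bad k)).card : ℝ) := by exact_mod_cast h1
  unfold uniformProb
  rw [← Finset.sum_div, sub_le_iff_le_add, ← add_div, le_div_iff₀ h0, one_mul]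
  exact h2

end Probability

lemma uniformProb_nonneg {Ω : Type*} [Fintype Ω] (A : Ω → Prop) : 0 ≤ uniformProb A := by
  unfold uniformProb
  positivity

lemma uniformProb_not {Ω : Type*} [Fintype Ω] [Nonempty Ω] (A : Ω → Prop) :
    uniformProb (fun ω => ¬ A ω) = 1 - uniformProb A := by
  have h0 : (Fintype.card Ω : ℝ) ≠ 0 := Nat.cast_ne_zero.2 Fintype.card_ne_zero
  have h1 := Finset.card_filter_add_card_filter_not (s := (Finset.univ : Finset Ω)) A
  rw [Finset.card_univ] at h1
  rw [uniformProb_eq, uniformProb_eq, eq_sub_iff_add_eq, ← add_div, div_eq_one_iff_eq h0, ← h1]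
  push_cast
  ring

/-! ### The indices of the levels -/

section Levels

variable {n : ℕ}

lemma one_le_logb_two (hn : 2 ≤ n) : 1 ≤ Real.logb 2 n := by
  rw [Real.le_logb_iff_rpow_le (by norm_num) (by positivity), Real.rpow_one]
  exact_mod_cast hn

lemma logLog_le (hn : 2 ≤ n) : (logLog n : ℝ) ≤ Real.logb 2 (Real.logb 2 n) :=
  Nat.floor_le (Real.logb_nonneg (by norm_num) (one_le_logb_two hn))

lemma logLog_add_one_le (hn : 2 ≤ n) : (logLog n : ℝ) + 1 ≤ 3 * Real.log n := by
  have h1 := logLog_le hn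
  have h2 := one_le_logb_two hn
  have h3 : Real.log (Real.logb 2 n) ≤ Real.logb 2 n - 1 :=
    Real.log_le_sub_one_of_pos (by linarith)
  have h4 : 0.69 < Real.log 2 := by have := Real.log_two_gt_d9; linarith
  have h5 : Real.log 2 < 1 := by have := Real.log_two_lt_d9; linarith
  have h6 : Real.logb 2 (Real.logb 2 n) * Real.log 2 = Real.log (Real.logb 2 n) :=
    div_mul_cancel₀ _ (by linarith)
  have h7 : Real.logb 2 n * Real.log 2 = Real.log n := div_mul_cancel₀ _ (by linarith)
  have h8 : ((logLog n : ℝ) + 1) * Real.log 2 ≤ Real.logb 2 n := by nlinarith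
  have h9 : 0 ≤ (logLog n : ℝ) + 1 := by positivity
  have h10 : ((logLog n : ℝ) + 1) * (0.69 * 0.69) ≤
      ((logLog n : ℝ) + 1) * (Real.log 2 * Real.log 2) := by gcongr
  nlinarith

lemma levelIndex_le_rpow (hn : 2 ≤ n) {i : ℕ} (hi : i ≤ logLog n) :
    (levelIndex n i : ℝ) ≤ (n : ℝ) ^ (1 - (2 : ℝ)⁻¹ ^ i) := by
  unfold levelIndex
  split_ifs with h0
  · simp [h0]
  · exact Nat.floor_le (by positivity)

lemma rpow_le_two_mul_levelIndex (hn : 2 ≤ n) {i : ℕ} (hi : i ≤ logLog n) :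
    (n : ℝ) ^ (1 - (2 : ℝ)⁻¹ ^ i) ≤ 2 * levelIndex n i := by
  unfold levelIndex
  split_ifs with h0
  · norm_num [h0]
  · have h1 : (1 : ℝ) ≤ (n : ℝ) ^ (1 - (2 : ℝ)⁻¹ ^ i) :=
      Real.one_le_rpow (by exact_mod_cast (by omega : 1 ≤ n))
        (sub_nonneg.2 (pow_le_one₀ (by norm_num) (by norm_num)))
    have h2 := Nat.lt_floor_add_one ((n : ℝ) ^ (1 - (2 : ℝ)⁻¹ ^ i))
    have h3 : (1 : ℝ) ≤ ⌊(n : ℝ) ^ (1 - (2 : ℝ)⁻¹ ^ i)⌋₊ := by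
      exact_mod_cast (Nat.one_le_floor_iff _).2 h1
    linarith

lemma levelIndex_lt (hn : 2 ≤ n) {i : ℕ} (hi : i ≤ logLog n) : levelIndex n i < n := by
  have h1 : (n : ℝ) ^ (1 - (2 : ℝ)⁻¹ ^ i) < (n : ℝ) ^ (1 : ℝ) :=
    Real.rpow_lt_rpow_of_exponent_lt (by exact_mod_cast (by omega : 1 < n))
      (sub_lt_self _ (by positivity))
  rw [Real.rpow_one] at h1
  exact_mod_cast (levelIndex_le_rpow hn hi).trans_lt h1

lemma levelIndex_of_lt {i : ℕ} (hi : logLog n < i) : levelIndex n i = n := by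
  rw [levelIndex, if_neg (by omega), if_neg (by omega)]

lemma one_le_levelIndex (hn : 2 ≤ n) (i : ℕ) : 1 ≤ levelIndex n i := by
  obtain hi | hi := le_or_gt i (logLog n)
  · have h1 := rpow_le_two_mul_levelIndex hn hi
    have h2 : (0 : ℝ) < (n : ℝ) ^ (1 - (2 : ℝ)⁻¹ ^ i) :=
      Real.rpow_pos_of_pos (by exact_mod_cast (by omega : 0 < n)) _
    have h3 : (0 : ℝ) < levelIndex n i := by linarith
    exact_mod_cast h3
  · rw [levelIndex_of_lt hi]
    omega

lemma levelIndex_le (hn : 2 ≤ n) (i : ℕ) : levelIndex n i ≤ n := by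
  obtain hi | hi := le_or_gt i (logLog n)
  · exact (levelIndex_lt hn hi).le
  · exact (levelIndex_of_lt hi).le

/-- The indices `k_i` are chosen so that `k_{i+1} ^ 2 / k_i` is at most of the order of `n`. At
the last level this holds because `n ^ (2 ^ (-logLog n))` is at most `4`. -/
lemma levelIndex_succ_sq_le (hn : 2 ≤ n) {i : ℕ} (hi : i ≤ logLog n) :
    (levelIndex n (i + 1) : ℝ) ^ 2 ≤ 8 * n * levelIndex n i := by
  have hn0 : (0 : ℝ) < n := by exact_mod_cast (by omega : 0 < n)
  have h1 := rpow_le_two_mul_levelIndex hn hi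
  obtain hlt | rfl := hi.lt_or_eq
  · have h2 := levelIndex_le_rpow hn (Nat.succ_le_of_lt hlt)
    have h3 : ((n : ℝ) ^ (1 - (2 : ℝ)⁻¹ ^ (i + 1))) ^ 2 = n * (n : ℝ) ^ (1 - (2 : ℝ)⁻¹ ^ i) := by
      rw [← Real.rpow_natCast, ← Real.rpow_mul hn0.le]
      nth_rewrite 2 [← Real.rpow_one (n : ℝ)]
      rw [← Real.rpow_add hn0]
      congr 1
      push_cast
      rw [pow_succ]
      ring
    calc (levelIndex n (i + 1) : ℝ) ^ 2 ≤ ((n : ℝ) ^ (1 - (2 : ℝ)⁻¹ ^ (i + 1))) ^ 2 := by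
          gcongr
      _ = n * (n : ℝ) ^ (1 - (2 : ℝ)⁻¹ ^ i) := h3
      _ ≤ n * (2 * levelIndex n i) := by gcongr
      _ ≤ 8 * n * levelIndex n i := by
          have : (0 : ℝ) ≤ n * levelIndex n i := by positivity
          linarith
  · have hlog := one_le_logb_two hn
    have h2 : Real.logb 2 (Real.logb 2 n) < ((logLog n + 1 : ℕ) : ℝ) := by
      push_cast
      exact Nat.lt_floor_add_one _
    rw [Real.logb_lt_iff_lt_rpow (by norm_num) (by linarith), Real.rpow_natCast] at h2
    have h3 : (n : ℝ) ^ ((2 : ℝ)⁻¹ ^ logLog n) ≤ 4 := by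
      have h4 : Real.logb 2 n * (2 : ℝ)⁻¹ ^ logLog n ≤ 2 := by
        rw [inv_pow, ← div_eq_mul_inv, div_le_iff₀ (by positivity), ← pow_succ']
        exact h2.le
      calc (n : ℝ) ^ ((2 : ℝ)⁻¹ ^ logLog n)
          = ((2 : ℝ) ^ Real.logb 2 n) ^ ((2 : ℝ)⁻¹ ^ logLog n) := by
            rw [Real.rpow_logb (by norm_num) (by norm_num) hn0]
        _ = (2 : ℝ) ^ (Real.logb 2 n * (2 : ℝ)⁻¹ ^ logLog n) :=
            (Real.rpow_mul (by norm_num) _ _).symm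
        _ ≤ (2 : ℝ) ^ (2 : ℝ) := Real.rpow_le_rpow_of_exponent_le (by norm_num) h4
        _ = 4 := by norm_num
    have h5 : (n : ℝ) = (n : ℝ) ^ ((2 : ℝ)⁻¹ ^ logLog n) *
        (n : ℝ) ^ (1 - (2 : ℝ)⁻¹ ^ logLog n) := by
      rw [← Real.rpow_add hn0, add_sub_cancel, Real.rpow_one]
    have h6 : (n : ℝ) ≤ 4 * (2 * levelIndex n (logLog n)) :=
      calc (n : ℝ) = _ := h5
        _ ≤ 4 * (2 * levelIndex n (logLog n)) :=
          mul_le_mul h3 h1 (Real.rpow_nonneg hn0.le _) (by norm_num)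
    rw [levelIndex_of_lt (Nat.lt_succ_self _), sq]
    calc (n : ℝ) * n ≤ n * (4 * (2 * levelIndex n (logLog n))) := by gcongr
      _ = _ := by ring

end Levels

end Sampling

/-! ### The level of a cut, and the likelihood ratio -/

section Level

variable {α β : Type*} {G : Graph α β} {T : SimpleGraph G.vertexSet}
  {w : Sym2 G.vertexSet → ℕ} {C : Set β} {p : ℝ} {n : ℕ}

lemma IsCut.levelGraph_last [Fintype α] (hn : n = G.vertexSet.ncard) (hC : G.IsCut C)
    (hCc : (C.ncard : ℝ) < 1.1 * G.minCut) : (G.levelGraph T w (logLog n + 1)).IsCut C := by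
  refine hC.contract (hCc.trans_le ?_)
  rw [← hn, levelIndex_of_lt (Nat.lt_succ_self _), gomoryHuValue, if_neg (by omega)]
  exact le_max_right _ _

lemma IsGomoryHuTree.ncard_vertexSet_levelGraph_le [Fintype α] (hT : G.IsGomoryHuTree T w)
    (hG : 0 < G.minCut) (hn : n = G.vertexSet.ncard) (hn2 : 2 ≤ n) (i : ℕ) :
    (G.levelGraph T w i).vertexSet.ncard ≤ levelIndex n i := by
  subst hn
  exact hT.ncard_vertexSet_contract_gomoryHuValue_le hG (one_le_levelIndex hn2 _)
    (levelIndex_le hn2 _)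

/-- The right level for a cut `C` is the first one whose contraction preserves `C`: at the level
before it, at least `k_i` cuts are as likely to fail as `C`. -/
lemma IsGomoryHuTree.exists_level [Fintype α] [Fintype β]
    (hT : G.IsGomoryHuTree T w) (hG : 0 < G.minCut) (hn : n = G.vertexSet.ncard) (hn2 : 2 ≤ n)
    (hp0 : 0 < p) (hp1 : p < 1)
    (hC : G.IsCut C) (hCc : (C.ncard : ℝ) < 1.1 * G.minCut) :
    ∃ i : Fin (logLog n + 1), (G.levelGraph T w (i + 1)).IsCut C ∧
      levelIndex n i * p ^ C.ncard ≤ G.nearMinCutSum p := by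
  let P : ℕ → Prop := fun i => (G.levelGraph T w (i + 1)).IsCut C
  have hP : ∃ i, P i := ⟨logLog n, hC.levelGraph_last hn hCc⟩
  have hle : Nat.find hP ≤ logLog n := Nat.find_min' hP (hC.levelGraph_last hn hCc)
  refine ⟨⟨Nat.find hP, Nat.lt_succ_of_le hle⟩, Nat.find_spec hP, ?_⟩
  obtain h0 | hpos := Nat.eq_zero_or_pos (Nat.find hP)
  · simpa [h0, levelIndex] using hC.pow_le_nearMinCutSum hCc hp0
  · refine hT.mul_pow_le_nearMinCutSum hG hp0 hp1 hCc (one_le_levelIndex hn2 _)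
      (hn ▸ levelIndex_lt hn2 hle) ?_
    by_contra hlt
    refine Nat.find_min hP (Nat.sub_lt hpos one_pos) (?_ : (G.levelGraph T w _).IsCut C)
    have h1 : 1 ≤ Nat.find hP := hpos
    rw [Nat.sub_add_cancel h1]
    refine hC.contract ?_
    rw [← hn]
    exact not_le.1 hlt

lemma likelihoodRatio_le [Fintype β] {q : Set β → ℝ} (hn2 : 2 ≤ n) (hp0 : 0 < p) {i : ℕ}
    (hi : i ≤ logLog n) (hz : levelIndex n i * p ^ C.ncard ≤ G.nearMinCutSum p) {r : ℕ}
    (hr : 0 < r)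
    (hq : 1 / (((logLog n + 1 : ℕ) : ℝ) * r * (levelIndex n (i + 1) : ℝ) ^ 2) ≤ q C) :
    G.likelihoodRatio p q C ≤ 24 * n * Real.log n * r := by
  have hr' : (0 : ℝ) < r := by exact_mod_cast hr
  have hk : (0 : ℝ) < levelIndex n i := by exact_mod_cast one_le_levelIndex hn2 i
  have hk' : (0 : ℝ) < levelIndex n (i + 1) := by exact_mod_cast one_le_levelIndex hn2 (i + 1)
  have hL : ((logLog n + 1 : ℕ) : ℝ) ≤ 3 * Real.log n := by
    push_cast
    exact logLog_add_one_le hn2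
  have hL0 : (0 : ℝ) < ((logLog n + 1 : ℕ) : ℝ) := by positivity
  have hpC : 0 < p ^ C.ncard := pow_pos hp0 _
  have hX : 0 < ((logLog n + 1 : ℕ) : ℝ) * r * (levelIndex n (i + 1) : ℝ) ^ 2 := by positivity
  have hq0 : 0 < q C := (one_div_pos.2 hX).trans_le hq
  have hz0 : 0 < G.nearMinCutSum p := (mul_pos hk hpC).trans_le hz
  rw [likelihoodRatio, div_le_iff₀ (mul_pos hq0 hz0)]
  have h1 : 1 ≤ q C * (((logLog n + 1 : ℕ) : ℝ) * r * (levelIndex n (i + 1) : ℝ) ^ 2) := by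
    rwa [div_le_iff₀ hX] at hq
  have h2 : ((logLog n + 1 : ℕ) : ℝ) * r * (levelIndex n (i + 1) : ℝ) ^ 2 ≤
      24 * n * Real.log n * r * levelIndex n i :=
    calc _ ≤ (3 * Real.log n) * r * (8 * n * levelIndex n i) := by
          gcongr
          exact levelIndex_succ_sq_le hn2 hi
      _ = _ := by ring
  have hlog : 0 ≤ Real.log n := Real.log_natCast_nonneg n
  calc p ^ C.ncard = 1 * p ^ C.ncard := (one_mul _).symm
    _ ≤ q C * (24 * n * Real.log n * r * levelIndex n i) * p ^ C.ncard := by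
        gcongr
        exact h1.trans (by gcongr)
    _ = 24 * n * Real.log n * r * (q C * (levelIndex n i * p ^ C.ncard)) := by ring
    _ ≤ 24 * n * Real.log n * r * (q C * G.nearMinCutSum p) := by gcongr

end Level

lemma minCut_pos_of_pow_lt {α β : Type*} {G : Graph α β} {n : ℕ} (hn2 : 2 ≤ n) {p : ℝ}
    (hp : p ^ G.minCut < (n : ℝ) ^ (-1000 : ℤ)) : 0 < G.minCut := by
  rw [Nat.pos_iff_ne_zero]
  intro h
  rw [h, pow_zero] at hp
  have h1 : (n : ℝ) ^ (-1000 : ℤ) ≤ 1 :=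
    zpow_le_one_of_nonpos₀ (by exact_mod_cast (by omega : 1 ≤ n)) (by norm_num)
  linarith

/-- If `r` independent events have probability at least `1 / 4` each, and `r` is at least
`4 * (d + 4) * log n`, then with probability at least `1 - n ^ (-(d + 4))` one of them occurs. -/
lemma pow_le_one_div_pow {n d r : ℕ} (hn2 : 2 ≤ n) (hr : 4 * ((d : ℝ) + 4) * Real.log n ≤ r)
    {x : ℝ} (hx0 : 0 ≤ x) (hx : x ≤ 3 / 4) : x ^ r ≤ 1 / (n : ℝ) ^ (d + 4) := by
  have hn0 : (0 : ℝ) < n := by exact_mod_cast (by omega : 0 < n)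
  calc x ^ r ≤ Real.exp (-(1 / 4)) ^ r := by
        gcongr
        have := Real.add_one_le_exp (-(1 / 4) : ℝ)
        linarith
    _ = Real.exp (-(r / 4)) := by
        rw [← Real.exp_nat_mul]
        congr 1
        ring
    _ ≤ Real.exp (-(((d + 4 : ℕ) : ℝ) * Real.log n)) := by
        rw [Real.exp_le_exp]
        push_cast
        linarith
    _ = 1 / (n : ℝ) ^ (d + 4) := by
        rw [Real.exp_neg, Real.exp_nat_mul, Real.exp_log hn0, one_div]

end Graph

open Graph in
theorem mainTheorem9 (d : ℕ) :
    ∃ A : ℝ, 0 < A ∧ ∀ (B : ℝ) (b : ℕ), ∃ (K : ℝ) (k : ℕ),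
      ∀ (α : Type u) (β : Type v) [Fintype α] [Fintype β] (G : Graph α β) (n : ℕ)
        (_hn : n = G.vertexSet.ncard) (_hn2 : 2 ≤ n)
        (p : ℝ) (_hp0 : 0 < p) (_hp1 : p < 1)
        (_hp : p ^ G.minCut < (n : ℝ) ^ (-1000 : ℤ))
        -- a Gomory–Hu tree
        (T : SimpleGraph G.vertexSet) (w : Sym2 G.vertexSet → ℕ)
        (_hT : G.IsGomoryHuTree T w)
        -- greedy tree packings on the contracted graphs; the index `i` stands for level `i + 1`
        (ε : ℝ) (_hε0 : 0 < ε) (_hε : ε ≤ 0.01)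
        (N : Fin (Graph.logLog n + 1) → ℕ) (_hN0 : ∀ i, 0 < N i)
        (_hN : ∀ i : Fin (Graph.logLog n + 1),
          6 * G.minCut * Real.log (G.levelGraph T w (i + 1)).edgeSet.ncard / ε ^ 2 ≤ N i)
        (𝒯 : ∀ i, Fin (N i) → Set β)
        (_h𝒯 : ∀ i : Fin (Graph.logLog n + 1),
          (G.levelGraph T w (i + 1)).IsGreedyPacking (𝒯 i))
        -- the number of trees sampled on each level
        (r : Fin (Graph.logLog n + 1) → ℕ)
        (_hr : ∀ i, A * Real.log n ≤ r i ∧ r i ≤ B * Real.log n ^ b),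
        1 - 1 / (n : ℝ) ^ d ≤
          Graph.uniformProb fun ω : (∀ i, Fin (r i) → Fin (N i)) =>
            ∀ C : Set β, G.IsCut C → (C.ncard : ℝ) < 1.1 * G.minCut →
              0 < Graph.sampleProb (fun i => G.levelGraph T w (i + 1))
                    (fun i j => 𝒯 i (ω i j)) C ∧
              G.likelihoodRatio p
                (Graph.sampleProb (fun i => G.levelGraph T w (i + 1)) fun i j => 𝒯 i (ω i j)) C
                ≤ K * n * Real.log n ^ k := by
  -- With this `A`, the sampled trees miss a given cut with probability at most `n ^ (-(d + 4))`.
  -- The surplus `n ^ 4` pays for the union bound over at most `4 * n ^ 2` cuts.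
  refine ⟨4 * ((d : ℝ) + 4), by positivity, fun B b => ⟨24 * B, b + 1, ?_⟩⟩
  intro α β _ _ G n hn hn2 p hp0 hp1 hp T w hT ε hε0 hε N hN0 hN 𝒯 h𝒯 r hr
  have hG := minCut_pos_of_pow_lt hn2 hp
  have hn0 : (0 : ℝ) < n := by exact_mod_cast (by omega : 0 < n)
  have hlog : 0 < Real.log n := Real.log_pos (by exact_mod_cast (by omega : 1 < n))
  have hne : ∀ i, Nonempty (Fin (N i)) := fun i => Fin.pos_iff_nonempty.1 (hN0 i)
  have hmin : ∀ (i : Fin (logLog n + 1)) (S : Set (Set α)),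
      ∀ x ∈ (G.levelGraph T w (i + 1)).vertexSet, ∀ y ∈ (G.levelGraph T w (i + 1)).vertexSet,
        x ∈ S → y ∉ S → G.minCut ≤ ((G.levelGraph T w (i + 1)).cutEdges S).ncard :=
    fun i S => minCut_le_ncard_cutEdges_contract S
  have hlev : ∀ C : Set β, ∃ i : Fin (logLog n + 1), G.IsCut C →
      (C.ncard : ℝ) < 1.1 * G.minCut → (G.levelGraph T w (i + 1)).IsCut C ∧
        levelIndex n i * p ^ C.ncard ≤ G.nearMinCutSum p := by
    intro C
    by_cases h : G.IsCut C ∧ (C.ncard : ℝ) < 1.1 * G.minCut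
    · obtain ⟨i, hi⟩ := hT.exists_level hG hn hn2 hp0 hp1 h.1 h.2
      exact ⟨i, fun _ _ => hi⟩
    · exact ⟨0, fun h1 h2 => absurd ⟨h1, h2⟩ h⟩
  choose lev hlev using hlev
  let 𝒞 := Finset.univ.filter fun C : Set β => G.IsCut C ∧ (C.ncard : ℝ) < 1.1 * G.minCut
  let bad : Set β → (∀ i, Fin (r i) → Fin (N i)) → Prop := fun C ω =>
    ∀ j, ¬ (C ∩ 𝒯 (lev C) (ω (lev C) j)).ncard ≤ 2
  have hunion : ∑ C ∈ 𝒞, uniformProb (bad C) ≤ 1 / (n : ℝ) ^ d := by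
    have hbad : ∀ C ∈ 𝒞, uniformProb (bad C) ≤ 1 / (n : ℝ) ^ (d + 4) := by
      intro C hC
      obtain ⟨hC, hCc⟩ := (Finset.mem_filter.1 hC).2
      have h1 := (h𝒯 (lev C)).le_four_mul_card hG (hmin _) hε0 hε (hN _) (hlev C hC hCc).1 hCc
      have h2 : uniformProb (bad C) =
          uniformProb (fun t => ¬ (C ∩ 𝒯 (lev C) t).ncard ≤ 2) ^ r (lev C) := by
        rw [uniformProb_apply (Ω := fun i => Fin (r i) → Fin (N i)) (lev C)
          (fun ω => ∀ j, ¬ (C ∩ 𝒯 (lev C) (ω j)).ncard ≤ 2),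
          uniformProb_forall (fun t => ¬ (C ∩ 𝒯 (lev C) t).ncard ≤ 2), Fintype.card_fin]
      rw [h2]
      refine pow_le_one_div_pow hn2 (hr _).1 (uniformProb_nonneg _) ?_
      rw [uniformProb_not, uniformProb_eq, Fintype.card_fin]
      have hN' : (0 : ℝ) < N (lev C) := by exact_mod_cast hN0 _
      have h3 : (1 / 4 : ℝ) ≤ ((Finset.univ.filter fun t =>
          (C ∩ 𝒯 (lev C) t).ncard ≤ 2).card : ℝ) / N (lev C) := by
        rw [le_div_iff₀ hN']
        linarith
      linarith
    have hcard : (𝒞.card : ℝ) ≤ 4 * (n : ℝ) ^ 2 := by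
      have h1 := (h𝒯 (Fin.last _)).card_nearMinCuts_le (hN0 _) hG (hmin _) hε0 hε (hN _)
      have h2 : (G.levelGraph T w ((Fin.last (logLog n)).val + 1)).vertexSet.ncard ≤ n :=
        (Set.ncard_image_le (Set.toFinite _)).trans hn.ge
      refine le_trans ?_ (h1.trans (by gcongr))
      refine Nat.cast_le.2 (Finset.card_le_card fun C hC => ?_)
      obtain ⟨hC, hCc⟩ := (Finset.mem_filter.1 hC).2
      exact Finset.mem_filter.2 ⟨Finset.mem_univ _, hC.levelGraph_last hn hCc, hCc⟩
    calc ∑ C ∈ 𝒞, uniformProb (bad C) ≤ 𝒞.card * (1 / (n : ℝ) ^ (d + 4)) := by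
          rw [← nsmul_eq_mul]
          exact Finset.sum_le_card_nsmul _ _ _ hbad
      _ ≤ (n : ℝ) ^ 2 * (n : ℝ) ^ 2 * (1 / (n : ℝ) ^ (d + 4)) := by
          gcongr
          refine hcard.trans ?_
          have : (2 : ℝ) ≤ n := by exact_mod_cast hn2
          gcongr
          nlinarith
      _ = 1 / (n : ℝ) ^ d := by
          rw [pow_add]
          field_simp
  refine (sub_le_sub_left hunion 1).trans (one_sub_sum_le_uniformProb 𝒞 bad ?_)
  intro ω hω C hC hCc
  obtain ⟨hcut, hz⟩ := hlev C hC hCc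
  have hω' := hω C (Finset.mem_filter.2 ⟨Finset.mem_univ _, hC, hCc⟩)
  obtain ⟨j, hj⟩ : ∃ j, (C ∩ 𝒯 (lev C) (ω (lev C) j)).ncard ≤ 2 := by
    simpa only [bad, not_forall, not_not] using hω'
  have hrpos : 0 < r (lev C) := j.pos
  have hq := one_div_le_sampleProb (H := fun i : Fin (logLog n + 1) => G.levelGraph T w (i + 1))
    (S := fun i j => 𝒯 i (ω i j)) (h𝒯 (lev C) (ω (lev C) j)).1 hcut hj
    (hT.ncard_vertexSet_levelGraph_le hG hn hn2 (lev C + 1))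
  have hk : (0 : ℝ) < levelIndex n (lev C + 1) := by exact_mod_cast one_le_levelIndex hn2 _
  have hr' : (0 : ℝ) < r (lev C) := by exact_mod_cast hrpos
  refine ⟨lt_of_lt_of_le (by positivity) hq, ?_⟩
  calc _ ≤ 24 * n * Real.log n * r (lev C) :=
        likelihoodRatio_le hn2 hp0 (Nat.lt_succ_iff.1 (lev C).2) hz hrpos hq
    _ ≤ 24 * n * Real.log n * (B * Real.log n ^ b) := by
        gcongr
        exact (hr _).2
    _ = 24 * B * n * Real.log n ^ (b + 1) := by ring
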